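/- Let $n\ge 1$ be an integer and let $\mathbb F_n=\mathbb P(\mathcal O_{\mathbb P^1}(n)\oplus\mathcal O_{\mathbb P^1})$ be the $n$-th Hirzebruch surface. Let $z_1$ be an affine coordinate on the base $\mathbb P^1$ and $z_2$ the corresponding affine fibre coordinate, normalized so that under the change of base coordinate $z_1'=1/z_1$ it becomes $z_2'=z_2/z_1^n$. For $s>0$ let $\omega_s$ be the Kähler metric on $\mathbb F_n$ given by $$\omega_s=\frac{\sqrt{-1}}{2}\,\partial\bar\partial\Big(\log(1+|z_1|^2)+s\log\big((1+|z_1|^2)^n+|z_2|^2\big)\Big),$$ which extends to all of $\mathbb F_n$. Writing $\omega_s=\frac{\sqrt{-1}}2\sum g_{i\bar j}\,dz_i\wedge d\bar z_j$ in local holomorphic coordinates, and with $R_{i\bar jk\bar l}=-\frac{\partial^2g_{i\bar j}}{\partial z_k\partial\bar z_l}+\sum_{p,q}g^{q\bar p}\frac{\partial g_{i\bar p}}{\partial z_k}\frac{\partial g_{q\bar j}}{\partial\bar z_l}$, where $\sum_j g^{i\bar j}g_{k\bar j}=\delta_{ik}$, let $$K_s(\xi)=\frac{2\sum R_{i\bar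 jk\bar l}\,\xi_i\bar\xi_j\xi_k\bar\xi_l}{\sum g_{i\bar j}g_{k\bar l}\,\xi_i\bar\xi_j\xi_k\bar\xi_l},\qquad \tau_s=\sum g^{i\bar j}g^{k\bar l}R_{i\bar jk\bar l}$$ be its holomorphic sectional curvature (for nonzero holomorphic tangent vectors $\xi$) and its scalar curvature. (i) For every $s>0$, at every point of $\mathbb F_n$, $$\frac32\cdot\frac{4-4n^2s}{1+s+2ns}\le\tau_s\le\frac32\cdot\frac4s .$$ (ii) For $0<s<\frac1{n^2}$, over all points of $\mathbb F_n$ and all nonzero holomorphic tangent vectors $\xi$, the minimum and maximum of $K_s$ are attained and $$\min_\xi K_s(\xi)=\frac{4-4n^2s}{1+s+2ns},\qquad \max_\xi K_s(\xi)=\frac4s ,$$ so that the bounds in (i) are $\frac32\min_\xi K_s(\xi)$ and $\frac32\max_\xi K_s(\xi)$. (iii) In particular, for $s=\frac1{2n^2+n}$, at every point of $\mathbb F_n$, $$\frac{6n(n+1)}{2n^2+3n+1}\le\tau_s\le 12n^2+6n .$$ -/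

import Mathlib

open scoped Manifold ContDiff

noncomputable section

/-! ### Hermitian geometry in local holomorphic coordinates -/

namespace HermitianGeometry

variable {m : ℕ}

/-- The Wirtinger derivative `∂f/∂z_k = (∂f/∂x_k - i ∂f/∂y_k) / 2`, where `z_k = x_k + i y_k`. -/
def wirtinger (k : Fin m) (f : (Fin m → ℂ) → ℂ) (z : Fin m → ℂ) : ℂ :=
  (fderiv ℝ f z (Pi.single k 1) - Complex.I * fderiv ℝ f z (Pi.single k Complex.I)) / 2

/-- The Wirtinger derivative `∂f/∂z̄_k = (∂f/∂x_k + i ∂f/∂y_k) / 2`, where `z_k = x_k + i y_k`. -/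
def wirtingerBar (k : Fin m) (f : (Fin m → ℂ) → ℂ) (z : Fin m → ℂ) : ℂ :=
  (fderiv ℝ f z (Pi.single k 1) + Complex.I * fderiv ℝ f z (Pi.single k Complex.I)) / 2

/-- The sesquilinear form `(v, w) ↦ ∑ ∂²φ/∂z_i∂z̄_j (z) v_i w̄_j`, i.e. the Hermitian form
`∑ g_{ij̄} dz_i ⊗ dz̄_j` at `z` whose associated `(1,1)`-form
`(√-1 / 2) ∑ g_{ij̄} dz_i ∧ dz̄_j` is `(√-1 / 2) ∂∂̄φ`. -/
def complexHessian (φ : (Fin m → ℂ) → ℂ) (z : Fin m → ℂ) :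
    (Fin m → ℂ) →ₗ[ℂ] (Fin m → ℂ) →ₗ⋆[ℂ] ℂ :=
  LinearMap.mk₂'ₛₗ (RingHom.id ℂ) (starRingEnd ℂ)
    (fun v w => ∑ i, ∑ j, wirtinger i (wirtingerBar j φ) z * v i * (starRingEnd ℂ) (w j))
    (fun v v' w => by
      simp only [Pi.add_apply, mul_add, add_mul, Finset.sum_add_distrib])
    (fun c v w => by
      simp only [Pi.smul_apply, smul_eq_mul, RingHom.id_apply, Finset.mul_sum]
      exact Finset.sum_congr rfl fun i _ => Finset.sum_congr rfl fun j _ => by ring)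
    (fun v w w' => by
      simp only [Pi.add_apply, map_add, mul_add, Finset.sum_add_distrib])
    (fun c v w => by
      simp only [Pi.smul_apply, smul_eq_mul, map_mul, Finset.mul_sum]
      exact Finset.sum_congr rfl fun i _ => Finset.sum_congr rfl fun j _ => by ring)

/-- A field of sesquilinear forms on the holomorphic tangent spaces of an `m`-dimensional complex
manifold. A Hermitian metric is such a field. -/
abbrev SesquilinearField (m : ℕ) (M : Type*) [TopologicalSpace M] [ChartedSpace (Fin m → ℂ) M] :=
  ∀ p : M, TangentSpace 𝓘(ℂ, Fin m → ℂ) p →ₗ[ℂ] TangentSpace 𝓘(ℂ, Fin m → ℂ) p →ₗ⋆[ℂ] ℂ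

/-- The curvature components
`R_{ij̄kl̄} = - ∂²g_{ij̄}/∂z_k∂z̄_l + ∑_{p,q} (∂g_{ip̄}/∂z_k) (G⁻¹)_{pq} (∂g_{qj̄}/∂z̄_l)`
of the metric connection of the Hermitian metric with matrix `G = (g_{ij̄})`. -/
def curvatureComponent (G : (Fin m → ℂ) → Matrix (Fin m) (Fin m) ℂ) (z : Fin m → ℂ)
    (i j k l : Fin m) : ℂ :=
  -wirtinger k (wirtingerBar l fun u => G u i j) z +
    ∑ p, ∑ q, wirtinger k (fun u => G u i p) z * (G z)⁻¹ p q *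
      wirtingerBar l (fun u => G u q j) z

variable {M : Type*} [TopologicalSpace M] [ChartedSpace (Fin m → ℂ) M]

/-- The matrix `(g_{ij̄})` of `g` with respect to the coordinate frame `∂/∂z_1, …, ∂/∂z_m` of the
chart `e`, as a function of the coordinates. -/
def coordMatrix (g : SesquilinearField m M) (e : OpenPartialHomeomorph M (Fin m → ℂ))
    (z : Fin m → ℂ) : Matrix (Fin m) (Fin m) ℂ :=
  Matrix.of fun i j =>
    g (e.symm z)
      (mfderiv 𝓘(ℂ, Fin m → ℂ) 𝓘(ℂ, Fin m → ℂ) e.symm z (Pi.single i (1 : ℂ) : Fin m → ℂ))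
      (mfderiv 𝓘(ℂ, Fin m → ℂ) 𝓘(ℂ, Fin m → ℂ) e.symm z (Pi.single j (1 : ℂ) : Fin m → ℂ))

/-- The curvature components `R_{ij̄kl̄}(p)` of `g` with respect to the preferred holomorphic
coordinates at `p`. -/
def curvatureAt (g : SesquilinearField m M) (p : M) (i j k l : Fin m) : ℂ :=
  curvatureComponent (coordMatrix g (chartAt (Fin m → ℂ) p)) (chartAt (Fin m → ℂ) p p) i j k l

/-- The matrix `(g_{ij̄}(p))` of `g` with respect to the preferred holomorphic coordinates at `p`. -/
def matrixAt (g : SesquilinearField m M) (p : M) : Matrix (Fin m) (Fin m) ℂ :=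
  coordMatrix g (chartAt (Fin m → ℂ) p) (chartAt (Fin m → ℂ) p p)

/-- The holomorphic sectional curvature
`K(ξ) = 2 ∑ R_{ij̄kl̄} ξ_i ξ̄_j ξ_k ξ̄_l / ∑ g_{ij̄} g_{kl̄} ξ_i ξ̄_j ξ_k ξ̄_l`
of a Hermitian metric (both sums are real). The tangent space at `p` is identified with `ℂ^m`
through the preferred chart at `p`, so that `ξ i` is the coefficient of `∂/∂z_i`. -/
def holSectCurv (g : SesquilinearField m M) (p : M) (ξ : TangentSpace 𝓘(ℂ, Fin m → ℂ) p) : ℝ :=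
  let v : Fin m → ℂ := ξ
  ((2 * ∑ i, ∑ j, ∑ k, ∑ l, curvatureAt g p i j k l *
        (v i * (starRingEnd ℂ) (v j) * v k * (starRingEnd ℂ) (v l))) /
    ∑ i, ∑ j, ∑ k, ∑ l, matrixAt g p i j * matrixAt g p k l *
        (v i * (starRingEnd ℂ) (v j) * v k * (starRingEnd ℂ) (v l))).re

/-- The scalar curvature `τ = ∑ g^{ij̄} g^{kl̄} R_{ij̄kl̄}` of a Hermitian metric (the sum is real),
where `g^{ij̄} = (G⁻¹)_{ji}`, i.e. `∑_j g^{ij̄} g_{kj̄} = δ_{ik}`. -/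
def scalarCurv (g : SesquilinearField m M) (p : M) : ℝ :=
  (∑ i, ∑ j, ∑ k, ∑ l,
    (matrixAt g p)⁻¹ j i * (matrixAt g p)⁻¹ l k * curvatureAt g p i j k l).re

end HermitianGeometry

/-! ### Hirzebruch surfaces -/

/-- Homogeneous coordinates `(x, y) = ((x₀, x₁), (y₀, y₁))` with `x ≠ 0` and `y ≠ 0`. -/
abbrev HirzebruchCoord : Type :=
  {v : (Fin 2 → ℂ) × (Fin 2 → ℂ) // v.1 ≠ 0 ∧ v.2 ≠ 0}

/-- The equivalence relation `(x₀, x₁, y₀, y₁) ∼ (λ x₀, λ x₁, λ⁻ⁿ μ y₀, μ y₁)`, `λ, μ ∈ ℂˣ`. -/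
def hirzebruchSetoid (n : ℕ) : Setoid HirzebruchCoord where
  r v w := ∃ l μ : ℂˣ, (∀ i, w.1.1 i = l * v.1.1 i) ∧
    w.1.2 0 = ((l⁻¹ : ℂˣ) : ℂ) ^ n * μ * v.1.2 0 ∧ w.1.2 1 = μ * v.1.2 1
  iseqv :=
    { refl := fun v => ⟨1, 1, by simp⟩
      symm := by
        rintro v w ⟨l, μ, h1, h2, h3⟩
        refine ⟨l⁻¹, μ⁻¹, fun i => ?_, ?_, ?_⟩
        · rw [h1]; simp
        · have hl : (l : ℂ) ^ n ≠ 0 := pow_ne_zero n l.ne_zero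
          rw [h2]; simp only [inv_inv, Units.val_inv_eq_inv_val, inv_pow]; field_simp
        · rw [h3]; simp
      trans := by
        rintro u v w ⟨l, μ, h1, h2, h3⟩ ⟨l', μ', h1', h2', h3'⟩
        refine ⟨l' * l, μ' * μ, fun i => ?_, ?_, ?_⟩
        · rw [h1', h1]; simp [mul_assoc]
        · rw [h2', h2]; simp only [mul_inv, Units.val_mul, mul_pow]; ring
        · rw [h3', h3]; simp [mul_assoc] }

/-- The `n`-th Hirzebruch surface `𝔽ₙ`, the `ℙ¹`-bundle `ℙ(𝒪(n) ⊕ 𝒪)` over `ℙ¹`: the point of the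
base is `[x₀ : x₁]`, and `(y₀, y₁)` are homogeneous coordinates in the fibre, such that
`y₁ / y₀` is a fibre coordinate of the line bundle `𝒪(n)`. -/
def Hirzebruch (n : ℕ) : Type := Quotient (hirzebruchSetoid n)

namespace Hirzebruch

variable {n : ℕ}

instance : TopologicalSpace (Hirzebruch n) :=
  inferInstanceAs (TopologicalSpace (Quotient (hirzebruchSetoid n)))

/-- The point with homogeneous coordinates `(x, y)`. -/
def mk (n : ℕ) (v : HirzebruchCoord) : Hirzebruch n := Quotient.mk (hirzebruchSetoid n) v

lemma isQuotientMap_mk : Topology.IsQuotientMap (mk n) := isQuotientMap_quot_mk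

/-- The section `z ↦ (x, y)`, `x_a = y_b = 1`, with the two remaining homogeneous coordinates equal
to `z 0` and `z 1`. -/
def lift (a b : Fin 2) (z : Fin 2 → ℂ) : HirzebruchCoord :=
  ⟨(fun i => if i = a then 1 else z 0, fun i => if i = b then 1 else z 1),
    fun h => by simpa using congrFun h a, fun h => by simpa using congrFun h b⟩

lemma continuous_lift (a b : Fin 2) : Continuous (lift a b) := by
  refine Continuous.subtype_mk (Continuous.prodMk ?_ ?_) _ <;>
  · refine continuous_pi fun i => ?_
    split_ifs <;> fun_prop

/-- The affine coordinates on `{x_a ≠ 0, y_b ≠ 0}`: `x_{1-a} / x_a` on the base, and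
`y₁ / (x_aⁿ y₀)` or its inverse in the fibre. -/
def preCoord (n : ℕ) (a b : Fin 2) (v : HirzebruchCoord) : Fin 2 → ℂ :=
  ![v.1.1 (1 - a) / v.1.1 a,
    if b = 0 then v.1.2 1 / (v.1.1 a ^ n * v.1.2 0) else v.1.1 a ^ n * v.1.2 0 / v.1.2 1]

lemma preCoord_eq (a b : Fin 2) (v w : HirzebruchCoord) (h : (hirzebruchSetoid n).r v w) :
    preCoord n a b v = preCoord n a b w := by
  obtain ⟨l, μ, h1, h2, h3⟩ := h
  have hl : (l : ℂ) ≠ 0 := l.ne_zero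
  have hμ : (μ : ℂ) ≠ 0 := μ.ne_zero
  have key : w.1.1 a ^ n * w.1.2 0 = μ * (v.1.1 a ^ n * v.1.2 0) := by
    have hl' : (l : ℂ) ^ n ≠ 0 := pow_ne_zero n hl
    rw [h1, h2, Units.val_inv_eq_inv_val, mul_pow, inv_pow]; field_simp
  unfold preCoord
  rw [key, h3, h1, h1, mul_div_mul_left _ _ hl, mul_div_mul_left _ _ hμ, mul_div_mul_left _ _ hμ]

/-- The affine coordinates, as a function on `𝔽ₙ`. -/
def coord (a b : Fin 2) : Hirzebruch n → (Fin 2 → ℂ) :=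
  Quotient.lift (preCoord n a b) fun v w h => preCoord_eq a b v w h

lemma coord_mk (a b : Fin 2) (v : HirzebruchCoord) : coord a b (mk n v) = preCoord n a b v := rfl

/-- The open set `{x_a ≠ 0, y_b ≠ 0}`. -/
def domain (a b : Fin 2) : Set (Hirzebruch n) :=
  {p | Quotient.lift (fun v : HirzebruchCoord => v.1.1 a ≠ 0 ∧ v.1.2 b ≠ 0)
    (by
      rintro v w ⟨l, μ, h1, h2, h3⟩
      fin_cases b <;> simp [h1, h2, h3]) p}

lemma mk_mem_domain (a b : Fin 2) (v : HirzebruchCoord) :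
    mk n v ∈ domain a b ↔ v.1.1 a ≠ 0 ∧ v.1.2 b ≠ 0 := Iff.rfl

lemma isOpen_domain (a b : Fin 2) : IsOpen (domain (n := n) a b) := by
  rw [← isQuotientMap_mk.isOpen_preimage]
  have h1 : IsOpen {v : HirzebruchCoord | v.1.1 a ≠ 0} :=
    isOpen_ne_fun (by fun_prop) continuous_const
  have h2 : IsOpen {v : HirzebruchCoord | v.1.2 b ≠ 0} :=
    isOpen_ne_fun (by fun_prop) continuous_const
  exact h1.inter h2

lemma lift_mem_domain (a b : Fin 2) (z : Fin 2 → ℂ) : mk n (lift a b z) ∈ domain a b := by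
  rw [mk_mem_domain]; simp [lift]

lemma preCoord_lift (a b : Fin 2) (z : Fin 2 → ℂ) : preCoord n a b (lift a b z) = z := by
  ext i
  fin_cases a <;> fin_cases b <;> fin_cases i <;> simp [preCoord, lift]

lemma mk_lift_preCoord (a b : Fin 2) (v : HirzebruchCoord) (ha : v.1.1 a ≠ 0)
    (hb : v.1.2 b ≠ 0) : mk n (lift a b (preCoord n a b v)) = mk n v := by
  refine Quotient.sound (s := hirzebruchSetoid n) ?_
  have hp : v.1.1 a ^ n ≠ 0 := pow_ne_zero n ha
  have hx : ∀ i, v.1.1 i = v.1.1 a * (lift a b (preCoord n a b v)).1.1 i := fun i => by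
    fin_cases a <;> fin_cases i <;> simp [lift, preCoord] <;> exact (mul_div_cancel₀ _ ha).symm
  fin_cases b
  · have h0 : v.1.2 0 ≠ 0 := hb
    refine ⟨Units.mk0 _ ha, Units.mk0 _ (mul_ne_zero hp h0), hx, ?_, ?_⟩
    · simp [lift]; field_simp
    · simp [lift, preCoord]; field_simp
  · have h0 : v.1.2 1 ≠ 0 := hb
    refine ⟨Units.mk0 _ ha, Units.mk0 _ h0, hx, ?_, ?_⟩
    · simp [lift, preCoord]; field_simp
    · simp [lift]

/-- The affine chart with domain `{x_a ≠ 0, y_b ≠ 0}`. For `a = b = 0` its coordinates are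
`z₁ = x₁ / x₀` and `z₂ = y₁ / (x₀ⁿ y₀)`. -/
def chart (n : ℕ) (a b : Fin 2) : OpenPartialHomeomorph (Hirzebruch n) (Fin 2 → ℂ) where
  toFun := coord a b
  invFun z := mk n (lift a b z)
  source := domain a b
  target := Set.univ
  map_source' _ _ := Set.mem_univ _
  map_target' z _ := lift_mem_domain a b z
  left_inv' p hp := by
    induction p using Quotient.inductionOn with
    | h v => exact mk_lift_preCoord a b v hp.1 hp.2
  right_inv' z _ := preCoord_lift a b z
  open_source := isOpen_domain a b
  open_target := isOpen_univ
  continuousOn_toFun := by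
    rw [isQuotientMap_mk.continuousOn_isOpen_iff (isOpen_domain a b)]
    have hc : ∀ i, Continuous fun v : HirzebruchCoord => v.1.1 i := fun i => by fun_prop
    have hd : ∀ i, Continuous fun v : HirzebruchCoord => v.1.2 i := fun i => by fun_prop
    refine continuousOn_pi.2 fun i => ?_
    fin_cases i
    · exact (hc _).continuousOn.div (hc _).continuousOn fun v hv => hv.1
    · fin_cases b
      · exact (hd 1).continuousOn.div (((hc a).pow n).mul (hd 0)).continuousOn
          fun v hv => mul_ne_zero (pow_ne_zero _ hv.1) hv.2
      · exact (((hc a).pow n).mul (hd 0)).continuousOn.div (hd 1).continuousOn fun v hv => hv.2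
  continuousOn_invFun :=
    (isQuotientMap_mk.continuous.comp (continuous_lift a b)).continuousOn

lemma exists_mem_domain (p : Hirzebruch n) : ∃ c : Fin 2 × Fin 2, p ∈ domain c.1 c.2 := by
  induction p using Quotient.inductionOn with
  | h v =>
    obtain ⟨a, ha⟩ := Function.ne_iff.1 v.2.1
    obtain ⟨b, hb⟩ := Function.ne_iff.1 v.2.2
    exact ⟨(a, b), ha, hb⟩

/-- The index of an affine chart around `p`. -/
def chartIndex (p : Hirzebruch n) : Fin 2 × Fin 2 := (exists_mem_domain p).choose

instance : ChartedSpace (Fin 2 → ℂ) (Hirzebruch n) where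
  atlas := {e | ∃ a b, e = chart n a b}
  chartAt p := chart n (chartIndex p).1 (chartIndex p).2
  mem_chart_source p := (exists_mem_domain p).choose_spec
  chart_mem_atlas _ := ⟨_, _, rfl⟩

/-- `𝔽ₙ` is a complex manifold. -/
instance : IsManifold 𝓘(ℂ, Fin 2 → ℂ) ω (Hirzebruch n) := by
  refine isManifold_of_contDiffOn _ _ _ ?_
  rintro _ _ ⟨a, b, rfl⟩ ⟨a', b', rfl⟩
  have hx : ∀ i, ContDiff ℂ ω fun z : Fin 2 → ℂ => (lift a b z).1.1 i := fun i => by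
    simp only [lift]; split_ifs <;> fun_prop
  have hy : ∀ i, ContDiff ℂ ω fun z : Fin 2 → ℂ => (lift a b z).1.2 i := fun i => by
    simp only [lift]; split_ifs <;> fun_prop
  have hs : ∀ z ∈ (𝓘(ℂ, Fin 2 → ℂ)).symm ⁻¹' ((chart n a b).symm ≫ₕ chart n a' b').source ∩
      Set.range 𝓘(ℂ, Fin 2 → ℂ), (lift a b z).1.1 a' ≠ 0 ∧ (lift a b z).1.2 b' ≠ 0 :=
    fun z hz => hz.1.2
  refine contDiffOn_pi.2 fun i => ?_
  fin_cases i
  · exact (hx _).contDiffOn.div (hx _).contDiffOn fun z hz => (hs z hz).1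
  · fin_cases b'
    · exact (hy 1).contDiffOn.div (((hx a').pow n).mul (hy 0)).contDiffOn
        fun z hz => mul_ne_zero (pow_ne_zero _ (hs z hz).1) (hs z hz).2
    · exact (((hx a').pow n).mul (hy 0)).contDiffOn.div (hy 1).contDiffOn fun z hz => (hs z hz).2

/-- The function `log |x|² + s log (|x|²ⁿ |y₀|² + |y₁|²)` of the homogeneous coordinates. -/
def homogeneousPotential (n : ℕ) (s : ℝ) (v : HirzebruchCoord) : ℝ :=
  Real.log (‖v.1.1 0‖ ^ 2 + ‖v.1.1 1‖ ^ 2) +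
    s * Real.log ((‖v.1.1 0‖ ^ 2 + ‖v.1.1 1‖ ^ 2) ^ n * ‖v.1.2 0‖ ^ 2 + ‖v.1.2 1‖ ^ 2)

/-- The local Kähler potential of `ω_s` in the chart `chart n a b`. -/
def localPotential (n : ℕ) (s : ℝ) (a b : Fin 2) (z : Fin 2 → ℂ) : ℂ :=
  (homogeneousPotential n s (lift a b z) : ℂ)

/-- In the coordinates `(z₁, z₂) = (z 0, z 1)` the potential of `ω_s` is
`log (1 + |z₁|²) + s log ((1 + |z₁|²)ⁿ + |z₂|²)`. -/
lemma localPotential_zero_zero (n : ℕ) (s : ℝ) (z : Fin 2 → ℂ) :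
    localPotential n s 0 0 z =
      ((Real.log (1 + ‖z 0‖ ^ 2) + s * Real.log ((1 + ‖z 0‖ ^ 2) ^ n + ‖z 1‖ ^ 2) : ℝ) : ℂ) := by
  simp [localPotential, homogeneousPotential, lift]

/-- Hitchin's metric `ω_s = (√-1 / 2) ∂∂̄ (log (1 + |z₁|²) + s log ((1 + |z₁|²)ⁿ + |z₂|²))` on `𝔽ₙ`.
At `p` it is the complex Hessian of the local potential in an affine chart around `p`, through which
the tangent space at `p` is identified with `ℂ²`. The choice of the affine chart does not matter,
because the potentials of two charts differ on the overlap by a real linear combination of functions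
`log |f|²` with `f` holomorphic and nowhere zero, which `∂∂̄` annihilates. -/
def hitchinMetric (n : ℕ) (s : ℝ) : HermitianGeometry.SesquilinearField 2 (Hirzebruch n) :=
  fun p => HermitianGeometry.complexHessian
    (localPotential n s (chartIndex p).1 (chartIndex p).2)
    (chart n (chartIndex p).1 (chartIndex p).2 p)

end Hirzebruch

end

/-! In every affine chart the potential is `κ log u + s log (1 + u^m |w|²)` with `u = 1 + |z|²`,
where `(κ, m)` is `(1 + ns, -n)` or `(1, n)`. With `p = (1 + u^m |w|²)⁻¹` and `H = κ + s m (1 - p)`,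
the metric is diagonal in the coframe `dz`, `θ = dw + m z̄ w u⁻¹ dz`: it equals `H u⁻² |dz|² + s u^m
p² |θ|²`. In this coframe the curvature has only a horizontal, a mixed and a vertical component
(`curvatureComponent_metricMatrix`).

The function `H` is affine in `p` and runs between `1` and `1 + ns`, so `p` can be eliminated. Put
`c = ns`, `η = 1/H`, and let `a ∈ [0, 1]` be the horizontal share of the squared norm of `ξ`. In
both kinds of chart `K = (4/s) (1 - (2 + c - s) η a² + (1 + c) η² (3a² - 2a))`, `τ = 6/s - (2/s) (2
+ c - s) η`. Since `0 < η ≤ 1`, part (i) is read off from the formula for `τ`, without averaging `K`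
and hence without an upper bound on `s`.

For (ii), at `η = 1` the bracket is `1 - 2(1 + c) a + (1 + s + 2c) a²`, with minimum `(s - c²)/(1 +
s + 2c)` at `a = (1 + c)/(1 + s + 2c)`. `curvature_quadratic_lower` shows that smaller `η` does not
go below this when `c² ≤ s`, which follows from `s < 1/n²`. The maximum is reached at `a = 0`. Both
extremes occur at a point of the section `y₀ = 0`, where `H = 1`. Part (iii) is a special case of
(i). -/

noncomputable section

/-! ### Wirtinger calculus. -/

namespace HermitianGeometry

variable {m : ℕ} {f g : (Fin m → ℂ) → ℂ} {a b a' b' : Fin m → ℂ} {z : Fin m → ℂ}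

/-- `f` is real differentiable at `z` with `df = ∑ a_k dz_k + ∑ b_k dz̄_k`. -/
def HasWirtingerAt (f : (Fin m → ℂ) → ℂ) (a b : Fin m → ℂ) (z : Fin m → ℂ) : Prop :=
  ∃ L : (Fin m → ℂ) →L[ℝ] ℂ, HasFDerivAt f L z ∧
    ∀ v, L v = ∑ k, (a k * v k + b k * (starRingEnd ℂ) (v k))

namespace HasWirtingerAt

lemma wirtinger_eq (h : HasWirtingerAt f a b z) (k : Fin m) : wirtinger k f z = a k := by
  obtain ⟨L, hL, hv⟩ := h
  simp only [wirtinger, hL.fderiv, hv, Finset.sum_add_distrib]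
  simp only [Pi.single_apply, apply_ite (starRingEnd ℂ), map_zero, map_one, Complex.conj_I,
    mul_ite, mul_zero, mul_one, Finset.sum_ite_eq', Finset.mem_univ, if_true]
  linear_combination (-(a k) / 2 + b k / 2) * Complex.I_mul_I

lemma wirtingerBar_eq (h : HasWirtingerAt f a b z) (k : Fin m) : wirtingerBar k f z = b k := by
  obtain ⟨L, hL, hv⟩ := h
  simp only [wirtingerBar, hL.fderiv, hv, Finset.sum_add_distrib]
  simp only [Pi.single_apply, apply_ite (starRingEnd ℂ), map_zero, map_one, Complex.conj_I,
    mul_ite, mul_zero, mul_one, Finset.sum_ite_eq', Finset.mem_univ, if_true]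
  linear_combination (a k / 2 - b k / 2) * Complex.I_mul_I

lemma congr_coeff (h : HasWirtingerAt f a b z) (ha : a = a') (hb : b = b') :
    HasWirtingerAt f a' b' z := ha ▸ hb ▸ h

lemma congr_fun (h : HasWirtingerAt f a b z) (hg : ∀ x, g x = f x) :
    HasWirtingerAt g a b z := by rwa [funext hg]

lemma const (c : ℂ) : HasWirtingerAt (fun _ => c) 0 0 z :=
  ⟨0, hasFDerivAt_const c z, by simp⟩

lemma coord (i : Fin m) : HasWirtingerAt (fun z => z i) (Pi.single i 1) 0 z :=
  ⟨ContinuousLinearMap.proj i, hasFDerivAt_apply i z,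
    fun v => by simp [Pi.single_apply]⟩

lemma conj_coord (i : Fin m) :
    HasWirtingerAt (fun z => (starRingEnd ℂ) (z i)) 0 (Pi.single i 1) z :=
  ⟨(Complex.conjCLE : ℂ →L[ℝ] ℂ).comp (ContinuousLinearMap.proj i),
    (Complex.conjCLE : ℂ →L[ℝ] ℂ).hasFDerivAt.comp z (hasFDerivAt_apply i z),
    fun v => by simp [Pi.single_apply]⟩

lemma add (hf : HasWirtingerAt f a b z) (hg : HasWirtingerAt g a' b' z) :
    HasWirtingerAt (fun z => f z + g z) (a + a') (b + b') z := by
  obtain ⟨L, hL, hv⟩ := hf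
  obtain ⟨L', hL', hv'⟩ := hg
  refine ⟨L + L', hL.add hL', fun v => ?_⟩
  simp only [add_apply, hv, hv', ← Finset.sum_add_distrib, Pi.add_apply]
  exact Finset.sum_congr rfl fun k _ => by ring

lemma mul (hf : HasWirtingerAt f a b z) (hg : HasWirtingerAt g a' b' z) :
    HasWirtingerAt (fun z => f z * g z) (f z • a' + g z • a) (f z • b' + g z • b) z := by
  obtain ⟨L, hL, hv⟩ := hf
  obtain ⟨L', hL', hv'⟩ := hg
  refine ⟨f z • L' + g z • L, hL.mul hL', fun v => ?_⟩
  simp only [add_apply, smul_apply, hv, hv', smul_eq_mul,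
    Finset.mul_sum, ← Finset.sum_add_distrib, Pi.add_apply, Pi.smul_apply]
  exact Finset.sum_congr rfl fun k _ => by ring

lemma comp_hasDerivAt {F : ℂ → ℂ} {F' : ℂ} (hF : HasDerivAt F F' (f z))
    (hf : HasWirtingerAt f a b z) :
    HasWirtingerAt (fun z => F (f z)) (F' • a) (F' • b) z := by
  obtain ⟨L, hL, hv⟩ := hf
  refine ⟨_, (hF.hasFDerivAt.restrictScalars ℝ).comp z hL, fun v => ?_⟩
  simp only [ContinuousLinearMap.comp_apply, hv, ContinuousLinearMap.coe_restrictScalars',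
    ContinuousLinearMap.toSpanSingleton_apply, smul_eq_mul, Finset.sum_mul,
    Pi.smul_apply]
  exact Finset.sum_congr rfl fun k _ => by ring

end HasWirtingerAt

/-- The value of a real derivative in terms of the two Wirtinger derivatives. -/
lemma _root_.DifferentiableAt.hasWirtingerAt (hf : DifferentiableAt ℝ f z) :
    HasWirtingerAt f (fun k => wirtinger k f z) (fun k => wirtingerBar k f z) z := by
  refine ⟨_, hf.hasFDerivAt, fun v => ?_⟩
  conv_lhs => rw [← Finset.univ_sum_single v, map_sum]
  refine Finset.sum_congr rfl fun k _ => ?_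
  have h1 : (Pi.single k (v k) : Fin m → ℂ) =
      (v k).re • (Pi.single k (1 : ℂ) : Fin m → ℂ) +
        (v k).im • (Pi.single k Complex.I : Fin m → ℂ) := by
    rw [← Pi.single_smul, ← Pi.single_smul, ← Pi.single_add]
    congr 1
    simp [Complex.re_add_im]
  have h2 : (starRingEnd ℂ) (v k) = (v k).re - (v k).im * Complex.I := by
    apply Complex.ext <;> simp
  have h3 : v k = (v k).re + (v k).im * Complex.I := (Complex.re_add_im _).symm
  rw [h1, h2, map_add, map_smul, map_smul]
  conv_rhs => rw [h3]
  simp only [wirtinger, wirtingerBar, Complex.real_smul, Complex.add_re, Complex.add_im,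
    Complex.mul_re, Complex.mul_im, Complex.ofReal_re, Complex.ofReal_im, Complex.I_re,
    Complex.I_im, mul_zero, mul_one, sub_self, add_zero, zero_add]
  linear_combination ((v k).im * fderiv ℝ f z (Pi.single k Complex.I)) * Complex.I_mul_I

end HermitianGeometry

/-! ### Holomorphic changes of coordinates and pluriharmonic functions. -/

namespace HermitianGeometry

open Filter Topology

variable {m m' : ℕ} {f g : (Fin m → ℂ) → ℂ} {z : Fin m → ℂ}

lemma HasWirtingerAt.of_hasFDerivAt {D : (Fin m → ℂ) →L[ℂ] ℂ} (h : HasFDerivAt f D z) :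
    HasWirtingerAt f (fun k => D (Pi.single k 1)) 0 z := by
  refine ⟨D.restrictScalars ℝ, h.restrictScalars ℝ, fun v => ?_⟩
  simp only [ContinuousLinearMap.coe_restrictScalars', Pi.zero_apply, zero_mul, add_zero]
  conv_lhs => rw [pi_eq_sum_univ' v, map_sum]
  exact Finset.sum_congr rfl fun k _ => by rw [map_smul, smul_eq_mul, mul_comm]

lemma HasWirtingerAt.conj_of_hasFDerivAt {D : (Fin m → ℂ) →L[ℂ] ℂ} (h : HasFDerivAt f D z) :
    HasWirtingerAt (fun z => (starRingEnd ℂ) (f z)) 0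
      (fun k => (starRingEnd ℂ) (D (Pi.single k 1))) z := by
  obtain ⟨L, hL, hv⟩ := HasWirtingerAt.of_hasFDerivAt h
  refine ⟨(Complex.conjCLE : ℂ →L[ℝ] ℂ).comp L,
    (Complex.conjCLE : ℂ →L[ℝ] ℂ).hasFDerivAt.comp z hL, fun v => ?_⟩
  simp [hv]

lemma HasWirtingerAt.sum {ι : Type*} (s : Finset ι) {F : ι → (Fin m → ℂ) → ℂ}
    {a b : ι → Fin m → ℂ} (h : ∀ i ∈ s, HasWirtingerAt (F i) (a i) (b i) z) :
    HasWirtingerAt (fun z => ∑ i ∈ s, F i z) (∑ i ∈ s, a i) (∑ i ∈ s, b i) z := by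
  classical
  induction s using Finset.induction_on with
  | empty => simpa using HasWirtingerAt.const 0
  | insert i s hi ih =>
    simp only [Finset.sum_insert hi]
    exact (h i (s.mem_insert_self i)).add (ih fun j hj => h j (Finset.mem_insert_of_mem hj))

/-- The differential of a holomorphic map is complex linear, so pulling back does not mix the `dz`
and `dz̄` parts. -/
lemma HasWirtingerAt.comp_holomorphic {φ : (Fin m' → ℂ) → ℂ} {T : (Fin m → ℂ) → Fin m' → ℂ}
    {T' : (Fin m → ℂ) →L[ℂ] Fin m' → ℂ} {a b : Fin m' → ℂ} (hφ : HasWirtingerAt φ a b (T z))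
    (hT : HasFDerivAt T T' z) :
    HasWirtingerAt (fun z => φ (T z)) (fun i => ∑ l, a l * T' (Pi.single i 1) l)
      (fun i => ∑ l, b l * (starRingEnd ℂ) (T' (Pi.single i 1) l)) z := by
  obtain ⟨L, hL, hv⟩ := hφ
  refine ⟨L.comp (T'.restrictScalars ℝ), hL.comp z (hT.restrictScalars ℝ), fun v => ?_⟩
  have hT' : ∀ l, T' v l = ∑ k, v k * T' (Pi.single k 1) l := fun l => by
    conv_lhs => rw [pi_eq_sum_univ' v, map_sum, Finset.sum_apply]
    exact Finset.sum_congr rfl fun k _ => by rw [map_smul, Pi.smul_apply, smul_eq_mul]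
  simp only [ContinuousLinearMap.comp_apply, hv, ContinuousLinearMap.coe_restrictScalars', hT',
    map_sum, map_mul, Finset.mul_sum, Finset.sum_mul, Finset.sum_add_distrib]
  rw [Finset.sum_comm, add_left_cancel_iff.2 Finset.sum_comm]
  congr 1 <;> exact Finset.sum_congr rfl fun _ _ => Finset.sum_congr rfl fun _ _ => by ring

lemma HasWirtingerAt.congr_of_eventuallyEq {a b : Fin m → ℂ} (h : HasWirtingerAt f a b z)
    (hg : g =ᶠ[𝓝 z] f) : HasWirtingerAt g a b z := by
  obtain ⟨L, hL, hv⟩ := h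
  exact ⟨L, hL.congr_of_eventuallyEq hg, hv⟩

/-- The function `log |f|²`, `f` holomorphic. -/
lemma HasWirtingerAt.log_norm_sq {D : (Fin m → ℂ) →L[ℂ] ℂ} (h : HasFDerivAt f D z)
    (h0 : f z ≠ 0) :
    HasWirtingerAt (fun z => ((Real.log (‖f z‖ ^ 2) : ℝ) : ℂ))
      (fun k => D (Pi.single k 1) / f z) (fun k => (starRingEnd ℂ) (D (Pi.single k 1) / f z)) z := by
  have h1 : f z * (starRingEnd ℂ) (f z) ∈ Complex.slitPlane := by
    rw [Complex.mul_conj, Complex.ofReal_mem_slitPlane]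
    exact Complex.normSq_pos.2 h0
  have h0' : (starRingEnd ℂ) (f z) ≠ 0 := (map_ne_zero _).2 h0
  refine ((((HasWirtingerAt.of_hasFDerivAt h).mul
    (HasWirtingerAt.conj_of_hasFDerivAt h)).comp_hasDerivAt
      (Complex.hasDerivAt_log h1)).congr_fun fun x => ?_).congr_coeff ?_ ?_
  · rw [Complex.mul_conj, ← Complex.sq_norm, Complex.ofReal_log (sq_nonneg _)]
  · ext k
    simp only [Pi.smul_apply, Pi.add_apply, Pi.zero_apply, smul_eq_mul]
    field_simp
    ring
  · ext k
    simp only [Pi.smul_apply, Pi.add_apply, Pi.zero_apply, smul_eq_mul, map_div₀]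
    field_simp
    ring

lemma contDiff_wirtingerBar {φ : (Fin m → ℂ) → ℂ} (hφ : ContDiff ℝ 2 φ) (k : Fin m) :
    ContDiff ℝ 1 (wirtingerBar k φ) := by
  have h := hφ.fderiv_right (m := 1) le_rfl
  unfold wirtingerBar
  fun_prop

/-- Change of holomorphic coordinates for `∂∂̄`, modulo pluriharmonic functions. -/
lemma complexHessian_change {φ : (Fin m' → ℂ) → ℂ} {ψ P : (Fin m → ℂ) → ℂ}
    {T : (Fin m → ℂ) → Fin m' → ℂ} {A B : Fin m → (Fin m → ℂ) → ℂ} (hφ : ContDiff ℝ 2 φ)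
    (hT : ContDiffAt ℂ ω T z) (hψ : ∀ᶠ x in 𝓝 z, ψ x = φ (T x) + P x)
    (hP : ∀ᶠ x in 𝓝 z, HasWirtingerAt P (fun j => B j x) (fun j => (starRingEnd ℂ) (A j x)) x)
    (hA : ∀ j, DifferentiableAt ℂ (A j) z) (i j : Fin m) :
    complexHessian φ (T z) (fderiv ℂ T z (Pi.single i 1)) (fderiv ℂ T z (Pi.single j 1)) =
      wirtinger i (wirtingerBar j ψ) z := by
  have hTd : ∀ᶠ x in 𝓝 z, DifferentiableAt ℂ T x :=
    (hT.eventually (by simp)).mono fun x hx => hx.differentiableAt (by simp)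
  -- The factors `∂T_l/∂z_j` and `A j` enter only conjugated. They are holomorphic, so the next
  -- derivative `∂/∂z_i` acts on `∂φ/∂z̄_l` alone; in particular `∂∂̄P = 0`.
  have h1 : wirtingerBar j ψ =ᶠ[𝓝 z] fun x => (∑ l, wirtingerBar l φ (T x) *
      (starRingEnd ℂ) (fderiv ℂ T x (Pi.single j 1) l)) + (starRingEnd ℂ) (A j x) := by
    filter_upwards [hψ.eventually_nhds, hP, hTd] with x hx hPx hTx
    have h2 := (((hφ.differentiable (by norm_num)) (T x)).hasWirtingerAt.comp_holomorphic
      hTx.hasFDerivAt).add hPx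
    exact (h2.congr_of_eventuallyEq hx).wirtingerBar_eq j
  have hD : ∀ l, DifferentiableAt ℂ (fun x => fderiv ℂ T x (Pi.single j 1) l) z := fun l => by
    have h3 : ContDiffAt ℂ ω (fderiv ℂ T) z := hT.fderiv_right (by simp)
    have h4 := h3.differentiableAt (by simp)
    exact differentiableAt_pi.1 (h4.clm_apply (differentiableAt_const _)) l
  have h5 := (HasWirtingerAt.sum Finset.univ fun l _ =>
    (((((contDiff_wirtingerBar hφ l).differentiable (by norm_num)) (T z)).hasWirtingerAt
      ).comp_holomorphic hTd.self_of_nhds.hasFDerivAt).mul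
      (HasWirtingerAt.conj_of_hasFDerivAt (hD l).hasFDerivAt)).add
      (HasWirtingerAt.conj_of_hasFDerivAt (hA j).hasFDerivAt)
  rw [(h5.congr_of_eventuallyEq h1).wirtinger_eq i]
  simp only [complexHessian, LinearMap.mk₂'ₛₗ_apply, Pi.add_apply, Finset.sum_apply, Pi.smul_apply,
    Pi.zero_apply, smul_eq_mul, mul_zero, zero_add, add_zero, Finset.mul_sum]
  rw [Finset.sum_comm]
  exact Finset.sum_congr rfl fun _ _ => Finset.sum_congr rfl fun _ _ => by ring

end HermitianGeometry

/-! ### Curvature of the model metric `∂∂̄ (κ log u + s log (1 + u^m |w|²))`. -/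

namespace HermitianGeometry

open MvPolynomial

/-- The functions `z, z̄, w, w̄, u⁻¹, u^m, (1 + u^m |w|²)⁻¹` on `ℂ²`, where `u = 1 + |z|²`. Polynomials
in them are closed under Wirtinger derivatives. -/
def atoms (m : ℤ) (z : Fin 2 → ℂ) : Fin 7 → ℂ :=
  ![z 0, (starRingEnd ℂ) (z 0), z 1, (starRingEnd ℂ) (z 1),
    (1 + z 0 * (starRingEnd ℂ) (z 0))⁻¹, (1 + z 0 * (starRingEnd ℂ) (z 0)) ^ m,
    (1 + (1 + z 0 * (starRingEnd ℂ) (z 0)) ^ m * (z 1 * (starRingEnd ℂ) (z 1)))⁻¹]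

lemma one_add_mul_conj_ne_zero (w : ℂ) : 1 + w * (starRingEnd ℂ) w ≠ 0 := by
  rw [Complex.mul_conj]
  exact_mod_cast (add_pos_of_pos_of_nonneg one_pos (Complex.normSq_nonneg w)).ne'

lemma fibre_ne_zero (m : ℤ) (z w : ℂ) :
    1 + (1 + z * (starRingEnd ℂ) z) ^ m * (w * (starRingEnd ℂ) w) ≠ 0 := by
  rw [Complex.mul_conj, Complex.mul_conj]
  have h : 0 < 1 + Complex.normSq z := add_pos_of_pos_of_nonneg one_pos (Complex.normSq_nonneg z)
  exact_mod_cast (add_pos_of_pos_of_nonneg one_pos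
    (mul_nonneg (zpow_nonneg h.le m) (Complex.normSq_nonneg w))).ne'

/-- `∂/∂z_k` on polynomials in the functions `atoms`. -/
def holDer (m : ℤ) (k : Fin 2) : Derivation ℂ (MvPolynomial (Fin 7) ℂ) (MvPolynomial (Fin 7) ℂ) :=
  mkDerivation ℂ (![
    ![1, 0, 0, 0, -X 1 * (X 4 * X 4), C (m : ℂ) * X 1 * X 4 * X 5,
      -(X 6 * X 6) * (C (m : ℂ) * X 1 * X 4 * X 5 * X 2 * X 3)],
    ![0, 0, 1, 0, 0, 0, -(X 6 * X 6) * X 5 * X 3]] k)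

/-- `∂/∂z̄_k` on polynomials in the functions `atoms`. -/
def antiholDer (m : ℤ) (k : Fin 2) :
    Derivation ℂ (MvPolynomial (Fin 7) ℂ) (MvPolynomial (Fin 7) ℂ) :=
  mkDerivation ℂ (![
    ![0, 1, 0, 0, -X 0 * (X 4 * X 4), C (m : ℂ) * X 0 * X 4 * X 5,
      -(X 6 * X 6) * (C (m : ℂ) * X 0 * X 4 * X 5 * X 2 * X 3)],
    ![0, 0, 0, 1, 0, 0, -(X 6 * X 6) * X 5 * X 2]] k)

lemma hasWirtingerAt_atoms (m : ℤ) (z : Fin 2 → ℂ) (i : Fin 7) :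
    HasWirtingerAt (fun z => atoms m z i) (fun k => aeval (atoms m z) (holDer m k (X i)))
      (fun k => aeval (atoms m z) (antiholDer m k (X i))) z := by
  have hu := ((HasWirtingerAt.const (z := z) (m := 2) 1).add
    ((HasWirtingerAt.coord (z := z) 0).mul (HasWirtingerAt.conj_coord 0)))
  have hne := one_add_mul_conj_ne_zero (z 0)
  have hq := hu.comp_hasDerivAt (hasDerivAt_inv hne)
  have hh := hu.comp_hasDerivAt (hasDerivAt_zpow m _ (Or.inl hne))
  have hp := ((HasWirtingerAt.const (z := z) (m := 2) 1).add (hh.mul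
    ((HasWirtingerAt.coord (z := z) 1).mul (HasWirtingerAt.conj_coord 1)))).comp_hasDerivAt
      (hasDerivAt_inv (fibre_ne_zero m _ _))
  -- Writing `u^(m-1)` as `u^m u⁻¹` keeps the derivatives inside the algebra generated by the atoms.
  simp only [zpow_sub_one₀ hne, ← inv_pow] at hq hh hp
  fin_cases i
  · refine (HasWirtingerAt.coord 0).congr_coeff ?_ ?_ <;> ext k <;> fin_cases k <;>
      simp [holDer, antiholDer, mkDerivation_X]
  · refine (HasWirtingerAt.conj_coord 0).congr_coeff ?_ ?_ <;> ext k <;> fin_cases k <;>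
      simp [holDer, antiholDer, mkDerivation_X]
  · refine (HasWirtingerAt.coord 1).congr_coeff ?_ ?_ <;> ext k <;> fin_cases k <;>
      simp [holDer, antiholDer, mkDerivation_X]
  · refine (HasWirtingerAt.conj_coord 1).congr_coeff ?_ ?_ <;> ext k <;> fin_cases k <;>
      simp [holDer, antiholDer, mkDerivation_X]
  · refine hq.congr_coeff ?_ ?_ <;> ext k <;> fin_cases k <;>
      simp only [holDer, antiholDer, mkDerivation_X, atoms, Fin.zero_eta, Fin.mk_one,
        Fin.reduceFinMk, Matrix.cons_val, Pi.add_apply, Pi.smul_apply, Pi.zero_apply, Pi.single_apply,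
        smul_eq_mul, map_mul, map_neg, map_zero, aeval_X, if_true, if_false, one_ne_zero] <;> ring
  · refine hh.congr_coeff ?_ ?_ <;> ext k <;> fin_cases k <;>
      simp [holDer, antiholDer, mkDerivation_X, atoms] <;> ring
  · refine hp.congr_coeff ?_ ?_ <;> ext k <;> fin_cases k <;>
      simp only [holDer, antiholDer, mkDerivation_X, atoms, Fin.zero_eta, Fin.mk_one,
        Fin.reduceFinMk, Matrix.cons_val, Pi.add_apply, Pi.smul_apply, Pi.zero_apply, Pi.single_apply,
        smul_eq_mul, map_mul, map_neg, aeval_X, aeval_C, if_true, if_false, one_ne_zero, zero_ne_one,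
        Algebra.algebraMap_self, RingHom.id_apply] <;> ring

/-- Wirtinger derivatives obey the Leibniz rule, so agreement with a derivation need only be checked
on generators. Iterated derivatives thus become formal computations with polynomials. -/
lemma hasWirtingerAt_aeval_atoms (m : ℤ) (z : Fin 2 → ℂ) (P : MvPolynomial (Fin 7) ℂ) :
    HasWirtingerAt (fun z => aeval (atoms m z) P) (fun k => aeval (atoms m z) (holDer m k P))
      (fun k => aeval (atoms m z) (antiholDer m k P)) z := by
  induction P using MvPolynomial.induction_on with
  | C c =>
    refine ((HasWirtingerAt.const c).congr_fun fun x => ?_).congr_coeff ?_ ?_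
    · simp
    · ext k; simp [holDer, derivation_C]
    · ext k; simp [antiholDer, derivation_C]
  | add P Q hP hQ =>
    refine ((hP.add hQ).congr_fun fun x => ?_).congr_coeff ?_ ?_
    · simp
    · ext k; simp
    · ext k; simp
  | mul_X P i hP =>
    refine ((hP.mul (hasWirtingerAt_atoms m z i)).congr_fun fun x => ?_).congr_coeff ?_ ?_
    · simp
    · ext k; simp [Derivation.leibniz]
    · ext k; simp [Derivation.leibniz]

lemma wirtinger_aeval_atoms (m : ℤ) (P : MvPolynomial (Fin 7) ℂ) (k : Fin 2) :
    wirtinger k (fun z => aeval (atoms m z) P) = fun z => aeval (atoms m z) (holDer m k P) :=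
  funext fun z => (hasWirtingerAt_aeval_atoms m z P).wirtinger_eq k

lemma wirtingerBar_aeval_atoms (m : ℤ) (P : MvPolynomial (Fin 7) ℂ) (k : Fin 2) :
    wirtingerBar k (fun z => aeval (atoms m z) P) =
      fun z => aeval (atoms m z) (antiholDer m k P) :=
  funext fun z => (hasWirtingerAt_aeval_atoms m z P).wirtingerBar_eq k


/-- The components of `∂∂̄ (κ log u + s log (1 + u^m |w|²))` as polynomials in the functions
`atoms`. -/
def metricPoly (κ s : ℂ) (m : ℤ) (i j : Fin 2) : MvPolynomial (Fin 7) ℂ :=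
  (C κ + C s * C (m : ℂ) * X 5 * X 2 * X 3 * X 6) * ![X 4, 0] i * ![X 4, 0] j +
    C s * X 5 * (X 6 * X 6) * ![C (m : ℂ) * X 1 * X 2 * X 4, 1] i *
      ![C (m : ℂ) * X 0 * X 3 * X 4, 1] j

/-- The matrix of the form `∂∂̄ (κ log u + s log (1 + u^m |w|²))`. -/
def metricMatrix (κ s : ℂ) (m : ℤ) (z : Fin 2 → ℂ) : Matrix (Fin 2) (Fin 2) ℂ :=
  Matrix.of fun i j => aeval (atoms m z) (metricPoly κ s m i j)

/-- The factor `κ + s m (1 - p)`, `p = (1 + u^m |w|²)⁻¹`, of `u⁻² |dz|²` in the metric. -/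
def horiz (κ s : ℂ) (m : ℤ) (z : Fin 2 → ℂ) : ℂ :=
  κ + s * m * (1 - atoms m z 6)

/-- Since `p = (1 + u^m |w|²)⁻¹`, one has `u^m |w|² p = 1 - p`. -/
lemma horiz_eq_add (κ s : ℂ) (m : ℤ) (z : Fin 2 → ℂ) :
    κ + s * m * atoms m z 5 * atoms m z 2 * atoms m z 3 * atoms m z 6 = horiz κ s m z := by
  have := inv_mul_cancel₀ (fibre_ne_zero m (z 0) (z 1))
  simp only [horiz, atoms, Matrix.cons_val]
  linear_combination s * m * this

/-- The coframe `dz, θ` diagonalises the metric, so the matrix is a product of triangular and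
diagonal factors that invert separately. -/
lemma metricMatrix_inv (κ s : ℂ) (hs : s ≠ 0) (m : ℤ) (z : Fin 2 → ℂ) (hH : horiz κ s m z ≠ 0) :
    (metricMatrix κ s m z)⁻¹ =
      !![(horiz κ s m z * atoms m z 4 ^ 2)⁻¹,
        -(m * atoms m z 1 * atoms m z 2 * atoms m z 4) * (horiz κ s m z * atoms m z 4 ^ 2)⁻¹;
        -(m * atoms m z 0 * atoms m z 3 * atoms m z 4) * (horiz κ s m z * atoms m z 4 ^ 2)⁻¹,
        (s * atoms m z 5 * atoms m z 6 ^ 2)⁻¹ +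
          (m * atoms m z 1 * atoms m z 2 * atoms m z 4) *
          (m * atoms m z 0 * atoms m z 3 * atoms m z 4) * (horiz κ s m z * atoms m z 4 ^ 2)⁻¹] := by
  have hq : atoms m z 4 ≠ 0 := inv_ne_zero (one_add_mul_conj_ne_zero _)
  have hh : atoms m z 5 ≠ 0 := zpow_ne_zero _ (one_add_mul_conj_ne_zero _)
  have hp : atoms m z 6 ≠ 0 := inv_ne_zero (fibre_ne_zero _ _ _)
  have hH' := horiz_eq_add κ s m z
  apply Matrix.inv_eq_right_inv
  ext i j
  fin_cases i <;> fin_cases j <;>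
    simp only [metricMatrix, metricPoly, Matrix.mul_apply, Fin.sum_univ_two, Fin.zero_eta,
      Fin.mk_one, Matrix.of_apply, Matrix.cons_val, map_add, map_mul, aeval_X, aeval_C,
      map_one, map_zero, Algebra.algebraMap_self, RingHom.id_apply, hH', Matrix.one_apply,
      if_true, if_false, one_ne_zero, zero_ne_one] <;>
    field_simp <;> ring

/-- The coefficients of the form `dw + m z̄ w u⁻¹ dz`, the dual of the vertical direction. -/
def coframe (m : ℤ) (z : Fin 2 → ℂ) (i : Fin 2) : ℂ :=
  ![m * atoms m z 1 * atoms m z 2 * atoms m z 4, 1] i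

/-- The complex conjugates of the coefficients `coframe`. -/
def coframeBar (m : ℤ) (z : Fin 2 → ℂ) (i : Fin 2) : ℂ :=
  ![m * atoms m z 0 * atoms m z 3 * atoms m z 4, 1] i

set_option maxHeartbeats 4000000 in
/-- The curvature in terms of the coframe `dz, dw + m z̄ w u⁻¹ dz`. -/
lemma curvatureComponent_metricMatrix (κ s : ℂ) (hs : s ≠ 0) (m : ℤ) (z : Fin 2 → ℂ)
    (hH : horiz κ s m z ≠ 0) (i j k l : Fin 2) :
    curvatureComponent (metricMatrix κ s m) z i j k l =
      (2 * horiz κ s m z - 2 * s * m ^ 2 * (1 - atoms m z 6) * atoms m z 6) * atoms m z 4 ^ 4 *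
        ![1, 0] i * ![1, 0] j * ![1, 0] k * ![1, 0] l +
      s * m * atoms m z 5 * atoms m z 6 ^ 2 * atoms m z 4 ^ 2 *
        (1 - 2 * atoms m z 6 + s * m * (1 - atoms m z 6) * atoms m z 6 / horiz κ s m z) *
        (![1, 0] i * ![1, 0] j * coframe m z k * coframeBar m z l +
         ![1, 0] i * ![1, 0] l * coframe m z k * coframeBar m z j +
         ![1, 0] k * ![1, 0] j * coframe m z i * coframeBar m z l +
         ![1, 0] k * ![1, 0] l * coframe m z i * coframeBar m z j) +
      2 * s * atoms m z 5 ^ 2 * atoms m z 6 ^ 4 *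
        coframe m z i * coframeBar m z j * coframe m z k * coframeBar m z l := by
  rw [curvatureComponent, metricMatrix_inv κ s hs m z hH]
  simp only [metricMatrix, Matrix.of_apply, wirtinger_aeval_atoms, wirtingerBar_aeval_atoms,
    Fin.sum_univ_two]
  -- The conjugate coordinates are now treated as independent variables. The only relations needed
  -- are the two that define `u⁻¹` and `p` as inverses. The constant `κ` is eliminated in favour of
  -- `H`, which occurs in the denominators, and each component becomes an identity of rational
  -- functions.
  have hqE : atoms m z 4 = (1 + atoms m z 0 * atoms m z 1)⁻¹ := rfl
  have hpE : atoms m z 6 = (1 + atoms m z 5 * (atoms m z 2 * atoms m z 3))⁻¹ := rfl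
  have hu : 1 + atoms m z 0 * atoms m z 1 ≠ 0 := one_add_mul_conj_ne_zero _
  have hE : 1 + atoms m z 5 * (atoms m z 2 * atoms m z 3) ≠ 0 := fibre_ne_zero _ _ _
  have hh : atoms m z 5 ≠ 0 := zpow_ne_zero _ (one_add_mul_conj_ne_zero _)
  rw [← mul_assoc] at hpE hE
  have hκ : κ = horiz κ s m z - s * m * (1 - atoms m z 6) := by rw [horiz]; ring
  simp only [coframe, coframeBar, metricPoly, holDer, antiholDer]
  generalize horiz κ s m z = H at *
  generalize atoms m z = A at *
  generalize (m : ℂ) = M at *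
  fin_cases i <;> fin_cases j <;> fin_cases k <;> fin_cases l
  all_goals
    simp only [Fin.zero_eta, Fin.mk_one, Matrix.cons_val,
      Matrix.cons_val', map_add, map_mul, map_neg, map_one,
      map_zero, Derivation.leibniz, derivation_C, mkDerivation_X, 
      smul_eq_mul, aeval_X, aeval_C, Algebra.algebraMap_self, RingHom.id_apply, mul_zero,
      zero_mul, mul_one, one_mul, add_zero, zero_add]
  all_goals
    generalize A 0 = x at *
    generalize A 1 = y at *
    generalize A 2 = w at *
    generalize A 3 = v at *
    generalize A 4 = q at *
    generalize A 5 = h at *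
    generalize A 6 = p at *
    subst hqE hpE hκ
    have hu' : 1 + y * x ≠ 0 := by rwa [mul_comm]
    have hE' : 1 + w * h * v ≠ 0 := by rwa [mul_comm w]
  all_goals
    field_simp
    ring

end HermitianGeometry

/-! ### The metric `ω_s` in the affine charts. -/

namespace Hirzebruch

open HermitianGeometry Filter Topology

variable {n : ℕ}

/-- The coefficient `κ` of `log (1 + |z₁|²)` in the potential in the charts `chart n a b`. -/
def baseCoeff (n : ℕ) (s : ℝ) (b : Fin 2) : ℝ := if b = 0 then 1 + n * s else 1

/-- The exponent `m` of `u = 1 + |z₁|²` in the potential `κ log u + s log (1 + u^m |z₂|²)` in the charts `chart n a b`. -/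
def fibreExponent (n : ℕ) (b : Fin 2) : ℤ := if b = 0 then -n else n

/-- For `b = 0`, pulling `u^n` out of `u^n + |w|²` moves `s n log u` into the first term and leaves
the exponent `-n`. For `b = 1` the potential already has this form. -/
lemma localPotential_eq (s : ℝ) (a b : Fin 2) (z : Fin 2 → ℂ) :
    localPotential n s a b z = ((baseCoeff n s b * Real.log (1 + ‖z 0‖ ^ 2) +
      s * Real.log (1 + (1 + ‖z 0‖ ^ 2) ^ fibreExponent n b * ‖z 1‖ ^ 2) : ℝ) : ℂ) := by
  have hu : 0 < 1 + ‖z 0‖ ^ 2 := by positivity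
  have hE : 0 < 1 + ((1 + ‖z 0‖ ^ 2) ^ n)⁻¹ * ‖z 1‖ ^ 2 := by positivity
  have hx : ‖(lift a b z).1.1 0‖ ^ 2 + ‖(lift a b z).1.1 1‖ ^ 2 = 1 + ‖z 0‖ ^ 2 := by
    fin_cases a <;> simp [lift, add_comm]
  rw [localPotential, homogeneousPotential, hx]
  congr 1
  fin_cases b
  · have h : (1 + ‖z 0‖ ^ 2) ^ n + ‖z 1‖ ^ 2 =
        (1 + ‖z 0‖ ^ 2) ^ n * (1 + ((1 + ‖z 0‖ ^ 2) ^ n)⁻¹ * ‖z 1‖ ^ 2) := by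
      field_simp
    simp only [lift, baseCoeff, fibreExponent, Fin.zero_eta, if_true, one_ne_zero, if_false,
      norm_one, one_pow, mul_one, zpow_neg, zpow_natCast]
    rw [h, Real.log_mul (pow_pos hu n).ne' hE.ne', Real.log_pow]
    ring
  · simp [lift, baseCoeff, fibreExponent, add_comm]

lemma contDiff_localPotential (s : ℝ) (a b : Fin 2) : ContDiff ℝ 2 (localPotential n s a b) := by
  rw [funext (localPotential_eq s a b)]
  have h0 : ∀ i, ContDiff ℝ 2 fun z : Fin 2 → ℂ => ‖z i‖ ^ 2 := fun i =>
    (contDiff_apply ℝ ℂ i).norm_sq ℝ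
  have hu : ContDiff ℝ 2 fun z : Fin 2 → ℂ => 1 + ‖z 0‖ ^ 2 := contDiff_const.add (h0 0)
  have hu0 : ∀ z : Fin 2 → ℂ, 1 + ‖z 0‖ ^ 2 ≠ 0 := fun z => by positivity
  have hh : ContDiff ℝ 2 fun z : Fin 2 → ℂ => (1 + ‖z 0‖ ^ 2) ^ fibreExponent n b := by
    unfold fibreExponent
    split_ifs
    · simp only [zpow_neg, zpow_natCast]
      exact (hu.pow n).inv fun z => pow_ne_zero n (hu0 z)
    · simp only [zpow_natCast]
      exact hu.pow n
  have hE : ∀ z : Fin 2 → ℂ, 1 + (1 + ‖z 0‖ ^ 2) ^ fibreExponent n b * ‖z 1‖ ^ 2 ≠ 0 :=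
    fun z => by positivity
  exact Complex.ofRealCLM.contDiff.comp ((contDiff_const.mul (hu.log hu0)).add
    (contDiff_const.mul ((contDiff_const.add (hh.mul (h0 1))).log hE)))

open MvPolynomial in
lemma wirtinger_wirtingerBar_localPotential (s : ℝ) (a b : Fin 2) (z : Fin 2 → ℂ) (i j : Fin 2) :
    wirtinger i (wirtingerBar j (localPotential n s a b)) z =
      metricMatrix (baseCoeff n s b) s (fibreExponent n b) z i j := by
  set κ : ℂ := Complex.ofReal (baseCoeff n s b)
  set m := fibreExponent n b
  let Q : Fin 2 → MvPolynomial (Fin 7) ℂ :=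
    ![(C κ + C (s : ℂ) * C (m : ℂ) * X 5 * X 2 * X 3 * X 6) * X 0 * X 4,
      C (s : ℂ) * X 5 * X 6 * X 2]
  -- The antiholomorphic derivative is already a polynomial in the atoms, although the logarithms
  -- are not. The second derivative is therefore a formal one.
  have h1 : wirtingerBar j (localPotential n s a b) = fun z => aeval (atoms m z) (Q j) := by
    funext z
    have hne := one_add_mul_conj_ne_zero (z 0)
    have hcu : 1 + z 0 * (starRingEnd ℂ) (z 0) = ((1 + ‖z 0‖ ^ 2 : ℝ) : ℂ) := by
      rw [Complex.mul_conj, ← Complex.sq_norm]; push_cast; rfl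
    have hcE : 1 + (1 + z 0 * (starRingEnd ℂ) (z 0)) ^ m * (z 1 * (starRingEnd ℂ) (z 1)) =
        ((1 + (1 + ‖z 0‖ ^ 2) ^ m * ‖z 1‖ ^ 2 : ℝ) : ℂ) := by
      rw [hcu, Complex.mul_conj, ← Complex.sq_norm]; push_cast; rfl
    have hu := ((HasWirtingerAt.const (z := z) (m := 2) 1).add
      ((HasWirtingerAt.coord (z := z) 0).mul (HasWirtingerAt.conj_coord 0)))
    have hh := hu.comp_hasDerivAt (hasDerivAt_zpow m _ (Or.inl hne))
    have hE := ((HasWirtingerAt.const (z := z) (m := 2) 1).add (hh.mul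
      ((HasWirtingerAt.coord (z := z) 1).mul (HasWirtingerAt.conj_coord 1))))
    have hlu := hu.comp_hasDerivAt (Complex.hasDerivAt_log (by
      rw [hcu, Complex.ofReal_mem_slitPlane]; positivity))
    have hlE := hE.comp_hasDerivAt (Complex.hasDerivAt_log (by
      rw [hcE, Complex.ofReal_mem_slitPlane]; positivity))
    have hφ := ((HasWirtingerAt.const κ).mul hlu).add ((HasWirtingerAt.const (s : ℂ)).mul hlE)
    have hφ' := hφ.congr_fun (g := localPotential n s a b) fun x => by
      rw [localPotential_eq, Complex.mul_conj, Complex.mul_conj, ← Complex.sq_norm,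
        ← Complex.sq_norm]
      push_cast [Complex.ofReal_log (show (0 : ℝ) ≤ 1 + ‖x 0‖ ^ 2 by positivity),
        Complex.ofReal_log (show (0 : ℝ) ≤
          1 + (1 + ‖x 0‖ ^ 2) ^ fibreExponent n b * ‖x 1‖ ^ 2 by positivity)]
      rfl
    rw [hφ'.wirtingerBar_eq]
    simp only [zpow_sub_one₀ hne]
    fin_cases j <;>
      simp only [Q, atoms, Fin.zero_eta, Fin.mk_one, Matrix.cons_val,
        Pi.add_apply, Pi.smul_apply, Pi.zero_apply, Pi.single_apply, smul_eq_mul, map_mul, map_add,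
        aeval_X, aeval_C, if_true, if_false, one_ne_zero, zero_ne_one, Algebra.algebraMap_self,
        RingHom.id_apply] <;> ring
  have hu : 1 + atoms m z 0 * atoms m z 1 ≠ 0 := one_add_mul_conj_ne_zero _
  have hE : 1 + atoms m z 5 * (atoms m z 2 * atoms m z 3) ≠ 0 := fibre_ne_zero _ _ _
  have hq : atoms m z 4 * (1 + atoms m z 0 * atoms m z 1) = 1 := inv_mul_cancel₀ hu
  have hp : atoms m z 6 * (1 + atoms m z 5 * (atoms m z 2 * atoms m z 3)) = 1 := inv_mul_cancel₀ hE
  rw [h1, wirtinger_aeval_atoms, metricMatrix, Matrix.of_apply]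
  beta_reduce
  clear h1
  generalize atoms m z = A at *
  fin_cases i <;> fin_cases j <;>
    simp only [Q, metricPoly, holDer, Fin.zero_eta, Fin.mk_one, Matrix.cons_val, map_add, map_mul,
      map_neg, Derivation.leibniz, derivation_C, mkDerivation_X, smul_eq_mul,
      aeval_X, aeval_C, Algebra.algebraMap_self, RingHom.id_apply, mul_zero, zero_mul, mul_one,
      add_zero, zero_add] <;>
    generalize A 0 = x at * <;>
    generalize A 1 = y at * <;>
    generalize A 2 = w at * <;>
    generalize A 3 = v at * <;>
    generalize A 4 = q at * <;>
    generalize A 5 = h at * <;>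
    generalize A 6 = p at * <;>
    obtain rfl := eq_inv_of_mul_eq_one_left hq <;>
    obtain rfl := eq_inv_of_mul_eq_one_left hp <;>
    clear hq hp <;>
    rw [← mul_assoc] at hE <;>
    field_simp <;> ring

/-- The change of the potential under a change of homogeneous coordinates. -/
lemma homogeneousPotential_smul (s : ℝ) {v w : HirzebruchCoord} {l μ : ℂ} (hl : l ≠ 0) (hμ : μ ≠ 0)
    (h1 : ∀ i, w.1.1 i = l * v.1.1 i) (h2 : w.1.2 0 = (l⁻¹) ^ n * μ * v.1.2 0)
    (h3 : w.1.2 1 = μ * v.1.2 1) :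
    homogeneousPotential n s w =
      homogeneousPotential n s v + (Real.log (‖l‖ ^ 2) + s * Real.log (‖μ‖ ^ 2)) := by
  have hl' : ‖l‖ ≠ 0 := norm_ne_zero_iff.2 hl
  have hμ' : ‖μ‖ ≠ 0 := norm_ne_zero_iff.2 hμ
  have hx : 0 < ‖v.1.1 0‖ ^ 2 + ‖v.1.1 1‖ ^ 2 := by
    obtain ⟨i, hi⟩ := Function.ne_iff.1 v.2.1
    have := norm_pos_iff.2 hi
    fin_cases i <;> simp only [Fin.zero_eta, Fin.mk_one] at this <;> positivity
  have hy : 0 < (‖v.1.1 0‖ ^ 2 + ‖v.1.1 1‖ ^ 2) ^ n * ‖v.1.2 0‖ ^ 2 + ‖v.1.2 1‖ ^ 2 := by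
    obtain ⟨i, hi⟩ := Function.ne_iff.1 v.2.2
    have := norm_pos_iff.2 hi
    fin_cases i <;> simp only [Fin.zero_eta, Fin.mk_one] at this <;> positivity
  have e1 : ‖w.1.1 0‖ ^ 2 + ‖w.1.1 1‖ ^ 2 = ‖l‖ ^ 2 * (‖v.1.1 0‖ ^ 2 + ‖v.1.1 1‖ ^ 2) := by
    rw [h1, h1, norm_mul, norm_mul]; ring
  have e2 : (‖w.1.1 0‖ ^ 2 + ‖w.1.1 1‖ ^ 2) ^ n * ‖w.1.2 0‖ ^ 2 + ‖w.1.2 1‖ ^ 2 =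
      ‖μ‖ ^ 2 * ((‖v.1.1 0‖ ^ 2 + ‖v.1.1 1‖ ^ 2) ^ n * ‖v.1.2 0‖ ^ 2 + ‖v.1.2 1‖ ^ 2) := by
    rw [e1, h2, h3, norm_mul, norm_mul, norm_mul, norm_pow, norm_inv, mul_pow, inv_pow]
    field_simp
    ring
  rw [homogeneousPotential, homogeneousPotential, e2, e1, Real.log_mul (pow_ne_zero 2 hl') hx.ne',
    Real.log_mul (pow_ne_zero 2 hμ') hy.ne']
  ring

/-- The scaling factors are given explicitly because the logarithms of their norms measure the
difference between the potentials of two charts. -/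
lemma smul_lift_preCoord (a b : Fin 2) (v : HirzebruchCoord) (ha : v.1.1 a ≠ 0)
    (hb : v.1.2 b ≠ 0) :
    (∀ i, v.1.1 i = v.1.1 a * (lift a b (preCoord n a b v)).1.1 i) ∧
      v.1.2 0 = (v.1.1 a)⁻¹ ^ n * (if b = 0 then v.1.1 a ^ n * v.1.2 0 else v.1.2 1) *
        (lift a b (preCoord n a b v)).1.2 0 ∧
      v.1.2 1 = (if b = 0 then v.1.1 a ^ n * v.1.2 0 else v.1.2 1) *
        (lift a b (preCoord n a b v)).1.2 1 := by
  have hp : v.1.1 a ^ n ≠ 0 := pow_ne_zero n ha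
  refine ⟨fun i => ?_, ?_⟩
  · fin_cases a <;> fin_cases i <;> simp [lift, preCoord] <;> exact (mul_div_cancel₀ _ ha).symm
  · fin_cases b
    · have h0 : v.1.2 0 ≠ 0 := hb
      simp [lift, preCoord]
      constructor <;> field_simp
    · have h0 : v.1.2 1 ≠ 0 := hb
      simp [lift, preCoord]
      field_simp

/-- The components of the metric in the affine coordinates of `chart n a b`. -/
lemma coordMatrix_hitchinMetric (s : ℝ) (a b : Fin 2) :
    coordMatrix (hitchinMetric n s) (chart n a b) =
      metricMatrix (baseCoeff n s b) s (fibreExponent n b) := by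
  funext z
  ext i j
  rw [← wirtinger_wirtingerBar_localPotential s a b z i j, coordMatrix, Matrix.of_apply]
  set q : Hirzebruch n := (chart n a b).symm z with hq
  set a' := (chartIndex q).1 with ha'
  set b' := (chartIndex q).2 with hb'
  have hqd : q ∈ domain a' b' := (exists_mem_domain q).choose_spec
  have hmd : MDifferentiableAt 𝓘(ℂ, Fin 2 → ℂ) 𝓘(ℂ, Fin 2 → ℂ) (chart n a b).symm z :=
    mdifferentiableAt_atlas_symm
      (show chart n a b ∈ atlas _ _ from ⟨a, b, rfl⟩) (Set.mem_univ _)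
  let T : (Fin 2 → ℂ) → Fin 2 → ℂ := fun x => preCoord n a' b' (lift a b x)
  -- The manifold derivative is expressed in the preferred chart at `q`, the same chart through
  -- which the metric at `q` is defined. It is therefore the derivative of the transition map `T`.
  have hmf : mfderiv 𝓘(ℂ, Fin 2 → ℂ) 𝓘(ℂ, Fin 2 → ℂ) (chart n a b).symm z = fderiv ℂ T z := by
    rw [hmd.mfderiv]
    simp only [mfld_simps, fderivWithin_univ]
    rfl
  rw [hmf]
  let l : (Fin 2 → ℂ) → ℂ := fun x => (lift a b x).1.1 a'
  let μ : (Fin 2 → ℂ) → ℂ := fun x =>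
    if b' = 0 then (lift a b x).1.1 a' ^ n * (lift a b x).1.2 0 else (lift a b x).1.2 1
  have hx : ∀ i, ContDiff ℂ ω fun z : Fin 2 → ℂ => (lift a b z).1.1 i := fun i => by
    simp only [lift]; split_ifs <;> fun_prop
  have hy : ∀ i, ContDiff ℂ ω fun z : Fin 2 → ℂ => (lift a b z).1.2 i := fun i => by
    simp only [lift]; split_ifs <;> fun_prop
  have hlc : ContDiff ℂ ω l := hx a'
  have hμc : ContDiff ℂ ω μ := by
    simp only [μ]
    split_ifs
    · exact ((hx a').pow n).mul (hy 0)
    · exact hy 1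
  have hdom : ∀ x : Fin 2 → ℂ, mk n (lift a b x) ∈ domain a' b' → l x ≠ 0 ∧ μ x ≠ 0 := by
    rintro x ⟨hxa, hyb⟩
    refine ⟨hxa, ?_⟩
    simp only [μ]
    split_ifs with h
    · exact mul_ne_zero (pow_ne_zero n hxa) (h ▸ hyb)
    · exact (show b' = 1 by omega) ▸ hyb
  have hev : ∀ᶠ x in 𝓝 z, mk n (lift a b x) ∈ domain a' b' :=
    (isQuotientMap_mk.continuous.comp (continuous_lift a b)).continuousAt.eventually_mem
      ((isOpen_domain a' b').mem_nhds hqd)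
  have hT : ContDiffAt ℂ ω T z := by
    obtain ⟨h1, h2⟩ := hdom z hqd
    refine contDiffAt_pi.2 fun i => ?_
    fin_cases i
    · exact (hx _).contDiffAt.div (hx _).contDiffAt h1
    · simp only [T, preCoord, μ] at h2 ⊢
      split_ifs at h2 ⊢
      · exact (hy 1).contDiffAt.div (((hx a').pow n).mul (hy 0)).contDiffAt h2
      · exact (((hx a').pow n).mul (hy 0)).contDiffAt.div (hy 1).contDiffAt h2
  refine complexHessian_change (ψ := localPotential n s a b) (T := T)
    -- The two lifts of a point differ by the scaling `(l, μ)`, so the potentials differ by `log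
    -- |l|² + s log |μ|²`. Here `A` is the logarithmic derivative `∂P`, which is holomorphic.
    (P := fun x => ((Real.log (‖l x‖ ^ 2) : ℝ) : ℂ) + s * ((Real.log (‖μ x‖ ^ 2) : ℝ) : ℂ))
    (A := fun j x => fderiv ℂ l x (Pi.single j 1) / l x + s * (fderiv ℂ μ x (Pi.single j 1) / μ x))
    (B := fun j x => fderiv ℂ l x (Pi.single j 1) / l x + s * (fderiv ℂ μ x (Pi.single j 1) / μ x))
    (contDiff_localPotential s a' b') hT ?_ ?_ ?_ i j
  · filter_upwards [hev] with x hxd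
    obtain ⟨h1, h2⟩ := hdom x hxd
    simp only [localPotential]
    obtain ⟨e1, e2, e3⟩ := smul_lift_preCoord a' b' (lift a b x) hxd.1 hxd.2
    rw [homogeneousPotential_smul (n := n) s (v := lift a' b' (T x)) h1 h2 e1 e2 e3]
    push_cast
    rfl
  · filter_upwards [hev] with x hxd
    obtain ⟨h1, h2⟩ := hdom x hxd
    refine ((HasWirtingerAt.log_norm_sq (hlc.differentiable (by simp) x).hasFDerivAt h1).add
      ((HasWirtingerAt.const (s : ℂ)).mul (HasWirtingerAt.log_norm_sq
        (hμc.differentiable (by simp) x).hasFDerivAt h2))).congr_coeff ?_ ?_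
    · ext k; simp
    · ext k; simp
  · intro k
    obtain ⟨h1, h2⟩ := hdom z hqd
    have hd : ∀ f : (Fin 2 → ℂ) → ℂ, ContDiff ℂ ω f →
        DifferentiableAt ℂ (fun x => fderiv ℂ f x (Pi.single k 1)) z := fun f hf =>
      ((hf.fderiv_right (m := 1) (by simp)).differentiable (by simp) z).clm_apply
        (differentiableAt_const _)
    simp only [div_eq_mul_inv]
    exact ((hd l hlc).mul ((hlc.differentiable (by simp) z).inv h1)).add
      (((hd μ hμc).mul ((hμc.differentiable (by simp) z).inv h2)).const_mul _)

end Hirzebruch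

/-! ### Contractions of the curvature tensor. -/

namespace HermitianGeometry

/-- `V` and `U` are the squared norms of the horizontal and vertical parts of `v`. Each of the four
mixed terms contributes the same multiple of `V U`. -/
lemma sum_curvatureComponent_metricMatrix (κ s : ℂ) (hs : s ≠ 0) (m : ℤ) (z : Fin 2 → ℂ)
    (hH : horiz κ s m z ≠ 0) (v : Fin 2 → ℂ) {V U : ℂ}
    (hV : V = horiz κ s m z * atoms m z 4 ^ 2 * (v 0 * (starRingEnd ℂ) (v 0)))
    (hU : U = s * atoms m z 5 * atoms m z 6 ^ 2 * ((coframe m z 0 * v 0 + v 1) *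
      (coframeBar m z 0 * (starRingEnd ℂ) (v 0) + (starRingEnd ℂ) (v 1)))) :
    ∑ i, ∑ j, ∑ k, ∑ l, curvatureComponent (metricMatrix κ s m) z i j k l *
        (v i * (starRingEnd ℂ) (v j) * v k * (starRingEnd ℂ) (v l)) =
      (2 * horiz κ s m z - 2 * s * m ^ 2 * (1 - atoms m z 6) * atoms m z 6) /
          horiz κ s m z ^ 2 * V ^ 2 +
        4 * (m * (1 - 2 * atoms m z 6 + s * m * (1 - atoms m z 6) * atoms m z 6 / horiz κ s m z) /
          horiz κ s m z) * (V * U) + 2 / s * U ^ 2 := by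
  have h1 : coframe m z 1 = 1 := rfl
  have h2 : coframeBar m z 1 = 1 := rfl
  subst hV hU
  simp only [curvatureComponent_metricMatrix κ s hs m z hH, Fin.sum_univ_two, Matrix.cons_val,
    h1, h2]
  field_simp
  ring

lemma metricMatrix_apply (κ s : ℂ) (m : ℤ) (z : Fin 2 → ℂ) (i j : Fin 2) :
    metricMatrix κ s m z i j =
      horiz κ s m z * atoms m z 4 ^ 2 * ![1, 0] i * ![1, 0] j +
        s * atoms m z 5 * atoms m z 6 ^ 2 * coframe m z i * coframeBar m z j := by
  have hH' := horiz_eq_add κ s m z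
  fin_cases i <;> fin_cases j <;>
    simp only [metricMatrix, metricPoly, coframe, coframeBar, Fin.zero_eta,
      Fin.mk_one, Matrix.of_apply, Matrix.cons_val, map_add, map_mul, MvPolynomial.aeval_X,
      MvPolynomial.aeval_C, map_one, map_zero, Algebra.algebraMap_self, RingHom.id_apply, hH'] <;>
    ring

lemma sum_metricMatrix (κ s : ℂ) (m : ℤ) (z v : Fin 2 → ℂ) {V U : ℂ}
    (hV : V = horiz κ s m z * atoms m z 4 ^ 2 * (v 0 * (starRingEnd ℂ) (v 0)))
    (hU : U = s * atoms m z 5 * atoms m z 6 ^ 2 * ((coframe m z 0 * v 0 + v 1) *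
      (coframeBar m z 0 * (starRingEnd ℂ) (v 0) + (starRingEnd ℂ) (v 1)))) :
    ∑ i, ∑ j, ∑ k, ∑ l, metricMatrix κ s m z i j * metricMatrix κ s m z k l *
        (v i * (starRingEnd ℂ) (v j) * v k * (starRingEnd ℂ) (v l)) = (V + U) ^ 2 := by
  have h1 : coframe m z 1 = 1 := rfl
  have h2 : coframeBar m z 1 = 1 := rfl
  subst hV hU
  simp only [metricMatrix_apply, Fin.sum_univ_two, Matrix.cons_val, h1, h2]
  ring

/-- Only two of the four mixed terms survive the trace: the other two pair `dz` with `θ`, which are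
orthogonal. -/
lemma sum_inv_curvatureComponent_metricMatrix (κ s : ℂ) (hs : s ≠ 0) (m : ℤ) (z : Fin 2 → ℂ)
    (hH : horiz κ s m z ≠ 0) :
    ∑ i, ∑ j, ∑ k, ∑ l, (metricMatrix κ s m z)⁻¹ j i * (metricMatrix κ s m z)⁻¹ l k *
        curvatureComponent (metricMatrix κ s m) z i j k l =
      (2 * horiz κ s m z - 2 * s * m ^ 2 * (1 - atoms m z 6) * atoms m z 6) /
          horiz κ s m z ^ 2 +
        2 * (m * (1 - 2 * atoms m z 6 + s * m * (1 - atoms m z 6) * atoms m z 6 / horiz κ s m z) /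
          horiz κ s m z) + 2 / s := by
  have hq : atoms m z 4 ≠ 0 := inv_ne_zero (one_add_mul_conj_ne_zero _)
  have hh : atoms m z 5 ≠ 0 := zpow_ne_zero _ (one_add_mul_conj_ne_zero _)
  have hp : atoms m z 6 ≠ 0 := inv_ne_zero (fibre_ne_zero _ _ _)
  have h0 : m * atoms m z 1 * atoms m z 2 * atoms m z 4 = coframe m z 0 := rfl
  have h0' : m * atoms m z 0 * atoms m z 3 * atoms m z 4 = coframeBar m z 0 := rfl
  have h1 : coframe m z 1 = 1 := rfl
  have h2 : coframeBar m z 1 = 1 := rfl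
  simp only [curvatureComponent_metricMatrix κ s hs m z hH, metricMatrix_inv κ s hs m z hH,
    Fin.sum_univ_two, Matrix.cons_val, Matrix.cons_val', Matrix.of_apply, h0, h0', h1, h2]
  field_simp
  ring

end HermitianGeometry

/-! ### The two quadratic inequalities behind the bounds on `K`. -/

section Bounds

variable {s c η a : ℝ}

/-- Lower bound for the holomorphic sectional curvature, up to the factor `4 / s`, in terms of the
proportion `a` of the horizontal part. -/
lemma curvature_quadratic_lower (hs : 0 < s) (hc : 0 ≤ c) (hcs : c ^ 2 ≤ s) (hsc : s ≤ 2 + c)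
    (h1 : 1 ≤ (1 + c) * η) (h2 : η ≤ 1) (ha : 0 ≤ a) (ha' : a ≤ 1) :
    (s - c ^ 2) / (1 + s + 2 * c) ≤
      1 - (2 + c - s) * η * a ^ 2 + (1 + c) * η ^ 2 * (3 * a ^ 2 - 2 * a) := by
  have hD : 0 < 1 + s + 2 * c := by positivity
  have hk : 0 < 1 + c := by positivity
  set G := (2 + c - s) * a + (1 + c) * (1 + η) * (2 - 3 * a) with hG
  -- This is the claim multiplied by `D = 1 + s + 2c`. The square is the excess over the minimum at
  -- `η = 1`, and `(1 - η) a G` is the change from `η = 1` to `η`.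
  have key : 0 ≤ ((1 + s + 2 * c) * a - (1 + c)) ^ 2 + (1 + s + 2 * c) * ((1 - η) * a * G) := by
    rcases le_or_gt 0 G with h | h
    · have : 0 ≤ (1 - η) * a * G := mul_nonneg (mul_nonneg (by linarith) ha) h
      positivity
    · have h3 : 2 < 3 * a := by
        by_contra! h3
        have : 0 ≤ (2 + c - s) * a := mul_nonneg (by linarith) ha
        have : 0 ≤ (1 + c) * (1 + η) * (2 - 3 * a) :=
          mul_nonneg (mul_nonneg hk.le (by nlinarith)) (by linarith)
        linarith
      have hg : -G ≤ (c + s) - (4 + 5 * c + s) * (1 - a) := by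
        have : 0 ≤ (1 - η) * ((1 + c) * (3 * a - 2)) :=
          mul_nonneg (by linarith) (mul_nonneg hk.le (by linarith))
        rw [hG]; linarith
      -- From `1 - η ≤ c/(1 + c)`. What remains is equivalent to `c² ≤ s`; this is where that
      -- hypothesis is used.
      have hε : (1 + s + 2 * c) * (1 - η) ≤ c + s := by
        have h4 : (1 + c) * (1 - η) ≤ c := by linarith
        have h5 : (1 + s + 2 * c) * ((1 + c) * (1 - η)) ≤ (1 + s + 2 * c) * c :=
          mul_le_mul_of_nonneg_left h4 hD.le
        have h6 : (1 + s + 2 * c) * c ≤ (1 + c) * (c + s) := by linarith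
        exact le_of_mul_le_mul_left (by linarith) hk
      -- With `t = 1 - a` the square is `((c + s) - D t)²`. It exceeds this bound by `(c + s)(2 + c
      -- - s) t + D² t²`, whose two terms are `h8` and `h9`.
      have h7 : (1 + s + 2 * c) * (1 - η) * (a * -G) ≤
          (c + s) * (1 * ((c + s) - (4 + 5 * c + s) * (1 - a))) := by
        have : 0 ≤ -G := by linarith
        have : 0 ≤ a * -G := mul_nonneg ha this
        gcongr
      have h8 : 0 ≤ (c + s) * ((2 + c - s) * (1 - a)) :=
        mul_nonneg (by positivity) (mul_nonneg (by linarith) (by linarith))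
      have h9 : 0 ≤ ((1 + s + 2 * c) * (1 - a)) ^ 2 := sq_nonneg _
      linarith
  rw [div_le_iff₀ hD]
  rw [hG] at key
  linarith

/-- Upper bound for the holomorphic sectional curvature, up to the factor `4 / s`. -/
lemma curvature_quadratic_upper (hs : s ≤ 1) (hc : 0 ≤ c)
    (h0 : 0 ≤ η) (h2 : η ≤ 1) (ha : 0 ≤ a) (ha' : a ≤ 1) :
    1 - (2 + c - s) * η * a ^ 2 + (1 + c) * η ^ 2 * (3 * a ^ 2 - 2 * a) ≤ 1 := by
  -- The claim is this inequality multiplied by `η a`.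
  have h3 : (1 + c) * η * (3 * a - 2) ≤ (2 + c - s) * a := by
    rcases le_total (3 * a) 2 with h | h
    · have : 0 ≤ (2 + c - s) * a := mul_nonneg (by linarith) ha
      have : (1 + c) * η * (3 * a - 2) ≤ 0 :=
        mul_nonpos_of_nonneg_of_nonpos (by positivity) (by linarith)
      linarith
    · calc (1 + c) * η * (3 * a - 2) ≤ (1 + c) * 1 * a := by gcongr; linarith
        _ ≤ _ := by nlinarith
  nlinarith [mul_le_mul_of_nonneg_left h3 (mul_nonneg h0 ha)]

end Bounds

/-! ### Curvatures of `ω_s` in terms of `η` and `a`. -/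

namespace Hirzebruch

open HermitianGeometry

variable {n : ℕ}

/-- The function `(1 + u^m |z₂|²)⁻¹`, `u = 1 + |z₁|²`. -/
def fibreWeight (m : ℤ) (z : Fin 2 → ℂ) : ℝ := (1 + (1 + ‖z 0‖ ^ 2) ^ m * ‖z 1‖ ^ 2)⁻¹

/-- The ratio of the horizontal part of `ω_s` to the Fubini–Study metric of the base. -/
def horizontalFactor (n : ℕ) (s : ℝ) (b : Fin 2) (z : Fin 2 → ℂ) : ℝ :=
  baseCoeff n s b + s * fibreExponent n b * (1 - fibreWeight (fibreExponent n b) z)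

lemma fibreWeight_pos (m : ℤ) (z : Fin 2 → ℂ) : 0 < fibreWeight m z := by
  unfold fibreWeight; positivity

lemma fibreWeight_le_one (m : ℤ) (z : Fin 2 → ℂ) : fibreWeight m z ≤ 1 :=
  inv_le_one_of_one_le₀ (le_add_of_nonneg_right (by positivity))

/-- The factor is `1 + ns P` for `b = 0` and `1 + ns (1 - P)` for `b = 1`, with `0 < P ≤ 1`. -/
lemma one_le_horizontalFactor {s : ℝ} (hs : 0 < s) (b : Fin 2) (z : Fin 2 → ℂ) :
    1 ≤ horizontalFactor n s b z := by
  have h1 := fibreWeight_pos (fibreExponent n b) z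
  have h2 := fibreWeight_le_one (fibreExponent n b) z
  have hc : 0 ≤ (n : ℝ) * s := by positivity
  unfold horizontalFactor
  generalize fibreWeight (fibreExponent n b) z = P at *
  fin_cases b <;> simp [baseCoeff, fibreExponent] <;> nlinarith

lemma horizontalFactor_le {s : ℝ} (hs : 0 < s) (b : Fin 2) (z : Fin 2 → ℂ) :
    horizontalFactor n s b z ≤ 1 + n * s := by
  have h1 := fibreWeight_pos (fibreExponent n b) z
  have h2 := fibreWeight_le_one (fibreExponent n b) z
  have hc : 0 ≤ (n : ℝ) * s := by positivity
  unfold horizontalFactor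
  generalize fibreWeight (fibreExponent n b) z = P at *
  fin_cases b <;> simp [baseCoeff, fibreExponent] <;> nlinarith

lemma atoms_four (m : ℤ) (z : Fin 2 → ℂ) : atoms m z 4 = (((1 + ‖z 0‖ ^ 2)⁻¹ : ℝ) : ℂ) := by
  simp only [atoms, Matrix.cons_val, Complex.mul_conj, ← Complex.sq_norm]
  push_cast; rfl

lemma atoms_five (m : ℤ) (z : Fin 2 → ℂ) : atoms m z 5 = (((1 + ‖z 0‖ ^ 2) ^ m : ℝ) : ℂ) := by
  simp only [atoms, Matrix.cons_val, Complex.mul_conj, ← Complex.sq_norm]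
  push_cast; rfl

lemma atoms_six (m : ℤ) (z : Fin 2 → ℂ) : atoms m z 6 = ((fibreWeight m z : ℝ) : ℂ) := by
  simp only [atoms, fibreWeight, Matrix.cons_val, Complex.mul_conj, ← Complex.sq_norm]
  push_cast; rfl

lemma horiz_eq (n : ℕ) (s : ℝ) (b : Fin 2) (z : Fin 2 → ℂ) :
    horiz (baseCoeff n s b) s (fibreExponent n b) z = ((horizontalFactor n s b z : ℝ) : ℂ) := by
  rw [horiz, atoms_six, horizontalFactor]; push_cast; rfl

lemma conj_coframe (m : ℤ) (z : Fin 2 → ℂ) :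
    (starRingEnd ℂ) (coframe m z 0) = coframeBar m z 0 := by
  simp only [coframe, coframeBar, Matrix.cons_val, atoms_four, map_mul, Complex.conj_ofReal,
    map_intCast]
  simp [atoms]

lemma matrixAt_hitchinMetric (s : ℝ) (p : Hirzebruch n) :
    matrixAt (hitchinMetric n s) p = metricMatrix (baseCoeff n s (chartIndex p).2) s
      (fibreExponent n (chartIndex p).2) (coord (chartIndex p).1 (chartIndex p).2 p) := by
  rw [← coordMatrix_hitchinMetric s (chartIndex p).1 (chartIndex p).2]
  rfl

lemma curvatureAt_hitchinMetric (s : ℝ) (p : Hirzebruch n) :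
    curvatureAt (hitchinMetric n s) p = curvatureComponent (metricMatrix
      (baseCoeff n s (chartIndex p).2) s (fibreExponent n (chartIndex p).2))
      (coord (chartIndex p).1 (chartIndex p).2 p) := by
  rw [← coordMatrix_hitchinMetric s (chartIndex p).1 (chartIndex p).2]
  rfl

/-- `R_{11̄11̄}` for a unit horizontal vector. -/
lemma horizontal_curvature {s : ℝ} (hs : 0 < s) (b : Fin 2) (z : Fin 2 → ℂ) :
    (2 * horizontalFactor n s b z - 2 * s * (fibreExponent n b : ℝ) ^ 2 *
        (1 - fibreWeight (fibreExponent n b) z) * fibreWeight (fibreExponent n b) z) /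
          horizontalFactor n s b z ^ 2 =
      2 / s * (1 - (2 + n * s - s) * (horizontalFactor n s b z)⁻¹ +
        (1 + n * s) * (horizontalFactor n s b z)⁻¹ ^ 2) := by
  have hH : horizontalFactor n s b z ≠ 0 := (one_pos.trans_le (one_le_horizontalFactor hs b z)).ne'
  field_simp
  simp only [horizontalFactor]
  generalize fibreWeight (fibreExponent n b) z = P
  -- Passing between the two kinds of chart exchanges `P` and `1 - P`, so the expression in terms of
  -- `H` is the same.
  fin_cases b <;> simp [baseCoeff, fibreExponent] <;> ring

/-- `R_{11̄22̄}` for unit vectors, the first horizontal and the second vertical. -/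
lemma mixed_curvature {s : ℝ} (hs : 0 < s) (b : Fin 2) (z : Fin 2 → ℂ) :
    (fibreExponent n b : ℝ) * (1 - 2 * fibreWeight (fibreExponent n b) z +
        s * fibreExponent n b * (1 - fibreWeight (fibreExponent n b) z) *
          fibreWeight (fibreExponent n b) z / horizontalFactor n s b z) /
          horizontalFactor n s b z =
      1 / s * (1 - (1 + n * s) * (horizontalFactor n s b z)⁻¹ ^ 2) := by
  have hH : horizontalFactor n s b z ≠ 0 := (one_pos.trans_le (one_le_horizontalFactor hs b z)).ne'
  field_simp
  simp only [horizontalFactor]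
  generalize fibreWeight (fibreExponent n b) z = P
  fin_cases b <;> simp [baseCoeff, fibreExponent] <;> ring

/-- The `η²` terms of the horizontal and mixed curvatures cancel in the trace, which leaves an
affine function of `η`. -/
lemma scalarCurv_hitchinMetric {s : ℝ} (hs : 0 < s) (p : Hirzebruch n) :
    scalarCurv (hitchinMetric n s) p = 6 / s - 2 / s * (2 + n * s - s) *
      (horizontalFactor n s (chartIndex p).2 (coord (chartIndex p).1 (chartIndex p).2 p))⁻¹ := by
  have hH : horizontalFactor n s (chartIndex p).2 (coord (chartIndex p).1 (chartIndex p).2 p) ≠ 0 :=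
    (one_pos.trans_le (one_le_horizontalFactor hs _ _)).ne'
  rw [scalarCurv, curvatureAt_hitchinMetric, matrixAt_hitchinMetric,
    sum_inv_curvatureComponent_metricMatrix _ _ (by exact_mod_cast hs.ne')]
  · rw [horiz_eq, atoms_six]
    have h1 := horizontal_curvature (n := n) hs (chartIndex p).2
      (coord (chartIndex p).1 (chartIndex p).2 p)
    have h2 := mixed_curvature (n := n) hs (chartIndex p).2
      (coord (chartIndex p).1 (chartIndex p).2 p)
    generalize horizontalFactor n s (chartIndex p).2 (coord _ _ p) = H at *
    generalize fibreWeight _ _ = P at *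
    -- All entries are casts of reals, so the real part is the same expression over `ℝ`.
    trans ((2 * H - 2 * s * (fibreExponent n (chartIndex p).2 : ℝ) ^ 2 * (1 - P) * P) / H ^ 2 +
        2 * ((fibreExponent n (chartIndex p).2 : ℝ) * (1 - 2 * P +
          s * fibreExponent n (chartIndex p).2 * (1 - P) * P / H) / H) + 2 / s)
    · rw [← Complex.ofReal_re (_ + _ + _)]
      push_cast
      rfl
    · rw [h1, h2]; ring
  · rw [horiz_eq]; exact_mod_cast hH

/-- The squared norm of the horizontal part of `v` with respect to `ω_s`. -/
def horizontalNormSq (n : ℕ) (s : ℝ) (b : Fin 2) (z v : Fin 2 → ℂ) : ℝ :=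
  horizontalFactor n s b z * (1 + ‖z 0‖ ^ 2)⁻¹ ^ 2 * ‖v 0‖ ^ 2

/-- The squared norm of the vertical part of `v` with respect to `ω_s`. -/
def verticalNormSq (n : ℕ) (s : ℝ) (b : Fin 2) (z v : Fin 2 → ℂ) : ℝ :=
  s * (1 + ‖z 0‖ ^ 2) ^ fibreExponent n b * fibreWeight (fibreExponent n b) z ^ 2 *
    ‖coframe (fibreExponent n b) z 0 * v 0 + v 1‖ ^ 2

lemma horizontalNormSq_nonneg {s : ℝ} (hs : 0 < s) (b : Fin 2) (z v : Fin 2 → ℂ) :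
    0 ≤ horizontalNormSq n s b z v := by
  have := one_pos.trans_le (one_le_horizontalFactor (n := n) hs b z)
  unfold horizontalNormSq
  positivity

lemma verticalNormSq_nonneg {s : ℝ} (hs : 0 < s) (b : Fin 2) (z v : Fin 2 → ℂ) :
    0 ≤ verticalNormSq n s b z v := by
  unfold verticalNormSq
  positivity

lemma normSq_pos {s : ℝ} (hs : 0 < s) (b : Fin 2) (z : Fin 2 → ℂ) {v : Fin 2 → ℂ} (hv : v ≠ 0) :
    0 < horizontalNormSq n s b z v + verticalNormSq n s b z v := by
  have hH := one_pos.trans_le (one_le_horizontalFactor (n := n) hs b z)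
  have hP := fibreWeight_pos (fibreExponent n b) z
  by_cases h0 : v 0 = 0
  · have h1 : v 1 ≠ 0 := fun h1 => hv (by ext i; fin_cases i <;> simp [h0, h1])
    refine add_pos_of_nonneg_of_pos (horizontalNormSq_nonneg hs b z v) ?_
    simp only [verticalNormSq, h0, mul_zero, zero_add]
    positivity
  · refine add_pos_of_pos_of_nonneg ?_ (verticalNormSq_nonneg hs b z v)
    unfold horizontalNormSq
    positivity

lemma holSectCurv_hitchinMetric {s : ℝ} (hs : 0 < s) (p : Hirzebruch n)
    {v : Fin 2 → ℂ} (hv : v ≠ 0) {b : Fin 2} {z : Fin 2 → ℂ} {η a : ℝ}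
    (hb : b = (chartIndex p).2) (hz : z = coord (chartIndex p).1 (chartIndex p).2 p)
    (hη : η = (horizontalFactor n s b z)⁻¹)
    (ha : a = horizontalNormSq n s b z v /
      (horizontalNormSq n s b z v + verticalNormSq n s b z v)) :
    holSectCurv (hitchinMetric n s) p v = 4 / s * (1 - (2 + n * s - s) * η * a ^ 2 +
      (1 + n * s) * η ^ 2 * (3 * a ^ 2 - 2 * a)) := by
  have hH : horizontalFactor n s b z ≠ 0 :=
    (one_pos.trans_le (one_le_horizontalFactor hs _ _)).ne'
  have hVU := normSq_pos (n := n) hs b z hv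
  have hV : ((horizontalNormSq n s b z v : ℝ) : ℂ) =
      horiz (baseCoeff n s b) s (fibreExponent n b) z * atoms (fibreExponent n b) z 4 ^ 2 *
        (v 0 * (starRingEnd ℂ) (v 0)) := by
    rw [horiz_eq, atoms_four, Complex.mul_conj, ← Complex.sq_norm, horizontalNormSq]
    push_cast; rfl
  have hU : ((verticalNormSq n s b z v : ℝ) : ℂ) = s * atoms (fibreExponent n b) z 5 *
      atoms (fibreExponent n b) z 6 ^ 2 *
      ((coframe (fibreExponent n b) z 0 * v 0 + v 1) *
      (coframeBar (fibreExponent n b) z 0 * (starRingEnd ℂ) (v 0) +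
        (starRingEnd ℂ) (v 1))) := by
    rw [atoms_five, atoms_six, ← conj_coframe, ← map_mul, ← map_add, Complex.mul_conj,
      ← Complex.sq_norm, verticalNormSq]
    push_cast; rfl
  have h1 := horizontal_curvature (n := n) hs b z
  have h2 := mixed_curvature (n := n) hs b z
  simp only [holSectCurv]
  rw [curvatureAt_hitchinMetric, matrixAt_hitchinMetric, ← hz, ← hb,
    sum_curvatureComponent_metricMatrix _ _ (by exact_mod_cast hs.ne') _ _
      (by rw [horiz_eq]; exact_mod_cast hH) v hV hU, sum_metricMatrix _ _ _ _ v hV hU]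
  rw [horiz_eq, atoms_six]
  clear hV hU hb hz
  generalize horizontalNormSq n s b z v = V at *
  generalize verticalNormSq n s b z v = U at *
  generalize horizontalFactor n s b z = H at *
  generalize fibreWeight _ _ = P at *
  trans 2 * ((2 * H - 2 * s * (fibreExponent n b : ℝ) ^ 2 * (1 - P) * P) / H ^ 2 * V ^ 2 +
        4 * ((fibreExponent n b : ℝ) * (1 - 2 * P +
          s * fibreExponent n b * (1 - P) * P / H) / H) * (V * U) + 2 / s * U ^ 2) / (V + U) ^ 2
  · rw [← Complex.ofReal_re (_ / _)]
    push_cast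
    rfl
  · rw [h1, h2, ← hη, ha]
    field_simp
    ring

/-! ### Bounds and extremal vectors. -/

/-- The point where the line `x₁ = 0` meets the section `y₀ = 0`; it lies in a single affine
chart. -/
def cornerPoint (n : ℕ) : Hirzebruch n := mk n (lift 0 1 0)

/-- The preferred chart is a matter of choice in general. Here only one chart contains the point, so
explicit tangent vectors can be evaluated. -/
lemma chartIndex_cornerPoint : chartIndex (cornerPoint n) = (0, 1) := by
  have h : cornerPoint n ∈ domain (chartIndex (cornerPoint n)).1 (chartIndex (cornerPoint n)).2 :=
    (exists_mem_domain (cornerPoint n)).choose_spec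
  obtain ⟨h1, h2⟩ := h
  simp only [lift, ne_eq, ite_eq_right_iff, Pi.zero_apply, one_ne_zero, imp_false, not_not]
    at h1 h2
  exact Prod.ext h1 h2

lemma holSectCurv_cornerPoint {s a : ℝ} (hs : 0 < s) {v : Fin 2 → ℂ} (hv : v ≠ 0)
    (ha : a = ‖v 0‖ ^ 2 / (‖v 0‖ ^ 2 + s * ‖v 1‖ ^ 2)) :
    holSectCurv (hitchinMetric n s) (cornerPoint n) v = 4 / s * (1 - (2 + n * s - s) * a ^ 2 +
      (1 + n * s) * (3 * a ^ 2 - 2 * a)) := by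
  have hz : coord 0 1 (cornerPoint n) = 0 := preCoord_lift 0 1 0
  have hH : horizontalFactor n s 1 0 = 1 := by
    simp [horizontalFactor, fibreWeight, baseCoeff]
  rw [holSectCurv_hitchinMetric (η := 1) (a := a) hs (cornerPoint n) hv (b := 1) (z := 0)]
  · ring
  · rw [chartIndex_cornerPoint]
  · rw [chartIndex_cornerPoint, hz]
  · rw [hH, inv_one]
  · rw [ha, horizontalNormSq, verticalNormSq, hH]
    simp [fibreWeight, coframe, atoms]

lemma scalarCurv_bounds (hn : 1 ≤ n) {s : ℝ} (hs : 0 < s) (p : Hirzebruch n) :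
    3 / 2 * ((4 - 4 * (n : ℝ) ^ 2 * s) / (1 + s + 2 * n * s)) ≤
        scalarCurv (hitchinMetric n s) p ∧
      scalarCurv (hitchinMetric n s) p ≤ 3 / 2 * (4 / s) := by
  have hn' : (1 : ℝ) ≤ n := by exact_mod_cast hn
  have hc : 0 ≤ 2 + n * s - s := by nlinarith
  rw [scalarCurv_hitchinMetric hs]
  have h1 := one_le_horizontalFactor (n := n) hs (chartIndex p).2
    (coord (chartIndex p).1 (chartIndex p).2 p)
  generalize horizontalFactor n s _ _ = H at *
  have h2 : H⁻¹ ≤ 1 := inv_le_one_of_one_le₀ h1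
  have h3 : 0 < H⁻¹ := inv_pos.2 (one_pos.trans_le h1)
  have h4 : 0 ≤ 2 / s * (2 + n * s - s) := by positivity
  constructor
  · have h5 : 3 / 2 * ((4 - 4 * (n : ℝ) ^ 2 * s) / (1 + s + 2 * n * s)) ≤
        6 / s - 2 / s * (2 + n * s - s) * 1 := by
      have h6 : 6 / s - 2 / s * (2 + n * s - s) * 1 = (2 - 2 * n * s + 2 * s) / s := by
        field_simp; ring
      rw [h6, ← mul_div_assoc, div_le_div_iff₀ (by positivity) hs]
      -- After clearing denominators the difference is `2 + 2(n - 1)s + 2ns² + 2s² + 2n²s²`.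
      nlinarith [sq_nonneg s, mul_nonneg hs.le (sub_nonneg.2 hn'), mul_pos hs hs,
        mul_nonneg (mul_pos hs hs).le (sub_nonneg.2 hn'), sq_nonneg (n * s)]
    nlinarith [mul_le_mul_of_nonneg_left h2 h4]
  · have : 3 / 2 * (4 / s) = 6 / s := by ring
    rw [this]
    nlinarith [mul_nonneg h4 h3.le]

lemma holSectCurv_bounds (hn : 1 ≤ n) {s : ℝ} (hs : 0 < s) (hsn : s < 1 / (n : ℝ) ^ 2)
    (p : Hirzebruch n) {v : Fin 2 → ℂ} (hv : v ≠ 0) :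
    (4 - 4 * (n : ℝ) ^ 2 * s) / (1 + s + 2 * n * s) ≤ holSectCurv (hitchinMetric n s) p v ∧
      holSectCurv (hitchinMetric n s) p v ≤ 4 / s := by
  have hn' : (1 : ℝ) ≤ n := by exact_mod_cast hn
  have hns : s * (n : ℝ) ^ 2 < 1 := (lt_div_iff₀ (by positivity)).1 hsn
  have hs1 : s ≤ 1 := by nlinarith
  have hc : 0 ≤ (n : ℝ) * s := by positivity
  have hcs : ((n : ℝ) * s) ^ 2 ≤ s := by nlinarith
  set b := (chartIndex p).2 with hb
  set z := coord (chartIndex p).1 b p with hz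
  rw [holSectCurv_hitchinMetric hs p hv hb hz rfl rfl]
  have h1 := one_le_horizontalFactor (n := n) hs b z
  have h2 := horizontalFactor_le (n := n) hs b z
  have hV := horizontalNormSq_nonneg (n := n) hs b z v
  have hU := verticalNormSq_nonneg (n := n) hs b z v
  have hVU := normSq_pos (n := n) hs b z hv
  have ha : 0 ≤ horizontalNormSq n s b z v /
      (horizontalNormSq n s b z v + verticalNormSq n s b z v) := by positivity
  have ha' : horizontalNormSq n s b z v /
      (horizontalNormSq n s b z v + verticalNormSq n s b z v) ≤ 1 :=
    (div_le_one hVU).2 (by linarith)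
  generalize horizontalNormSq n s b z v /
      (horizontalNormSq n s b z v + verticalNormSq n s b z v) = a at *
  generalize horizontalFactor n s b z = H at *
  have hH : 0 < H := one_pos.trans_le h1
  have h3 : H⁻¹ ≤ 1 := inv_le_one_of_one_le₀ h1
  have h4 : 1 ≤ (1 + n * s) * H⁻¹ := by
    rw [← div_eq_mul_inv, one_le_div hH]; exact h2
  have h5 := curvature_quadratic_lower hs hc hcs (by linarith) h4 h3 ha ha'
  have h6 := curvature_quadratic_upper hs1 hc (inv_pos.2 hH).le h3 ha ha'
  have h7 : 0 < 4 / s := by positivity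
  constructor
  · calc (4 - 4 * (n : ℝ) ^ 2 * s) / (1 + s + 2 * n * s)
        = 4 / s * ((s - (n * s) ^ 2) / (1 + s + 2 * (n * s))) := by field_simp
      _ ≤ _ := mul_le_mul_of_nonneg_left h5 h7.le
  · calc _ ≤ 4 / s * 1 := mul_le_mul_of_nonneg_left h6 h7.le
      _ = 4 / s := mul_one _

lemma exists_holSectCurv_eq_min {s : ℝ} (hs : 0 < s) :
    ∃ v : Fin 2 → ℂ, v ≠ 0 ∧ holSectCurv (hitchinMetric n s) (cornerPoint n) v =
      (4 - 4 * (n : ℝ) ^ 2 * s) / (1 + s + 2 * n * s) := by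
  have h0 : 0 < s * (1 + n * s) := by positivity
  have h1 : 0 < s + n * s := by positivity
  -- The entries are chosen so that `|v₀|² / (|v₀|² + s |v₁|²) = (1 + ns)/(1 + s + 2ns)`, the
  -- minimising `a` at `η = 1`.
  refine ⟨![(Real.sqrt (s * (1 + n * s)) : ℝ), (Real.sqrt (s + n * s) : ℝ)], fun h => ?_, ?_⟩
  · have := congrFun h 0
    simp only [Matrix.cons_val_zero, Pi.zero_apply, Complex.ofReal_eq_zero] at this
    exact (Real.sqrt_pos.2 h0).ne' this
  · rw [holSectCurv_cornerPoint (a := (1 + n * s) / (1 + s + 2 * n * s)) hs]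
    · field_simp
      ring
    · intro h
      have := congrFun h 0
      simp only [Matrix.cons_val_zero, Pi.zero_apply, Complex.ofReal_eq_zero] at this
      exact (Real.sqrt_pos.2 h0).ne' this
    · simp only [Matrix.cons_val_zero, Matrix.cons_val_one, Complex.norm_real, Real.norm_eq_abs,
        sq_abs, Real.sq_sqrt h0.le, Real.sq_sqrt h1.le]
      field_simp
      ring

lemma holSectCurv_vertical {s : ℝ} (hs : 0 < s) :
    holSectCurv (hitchinMetric n s) (cornerPoint n) (Pi.single 1 1 : Fin 2 → ℂ) = 4 / s := by
  rw [holSectCurv_cornerPoint (a := 0) hs (by simp)]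
  · ring
  · simp

end Hirzebruch

end

/-! ### The main theorem. -/

theorem mainTheorem3 (n : ℕ) (hn : 1 ≤ n) :
    (∀ s : ℝ, 0 < s → ∀ p : Hirzebruch n,
      3 / 2 * ((4 - 4 * (n : ℝ) ^ 2 * s) / (1 + s + 2 * n * s)) ≤
          HermitianGeometry.scalarCurv (Hirzebruch.hitchinMetric n s) p ∧
        HermitianGeometry.scalarCurv (Hirzebruch.hitchinMetric n s) p ≤ 3 / 2 * (4 / s)) ∧
    (∀ s : ℝ, 0 < s → s < 1 / (n : ℝ) ^ 2 →
      IsLeast {κ : ℝ | ∃ (p : Hirzebruch n) (ξ : TangentSpace 𝓘(ℂ, Fin 2 → ℂ) p), ξ ≠ 0 ∧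
          HermitianGeometry.holSectCurv (Hirzebruch.hitchinMetric n s) p ξ = κ}
        ((4 - 4 * (n : ℝ) ^ 2 * s) / (1 + s + 2 * n * s)) ∧
      IsGreatest {κ : ℝ | ∃ (p : Hirzebruch n) (ξ : TangentSpace 𝓘(ℂ, Fin 2 → ℂ) p), ξ ≠ 0 ∧
          HermitianGeometry.holSectCurv (Hirzebruch.hitchinMetric n s) p ξ = κ} (4 / s)) ∧
    (∀ p : Hirzebruch n,
      6 * (n : ℝ) * (n + 1) / (2 * (n : ℝ) ^ 2 + 3 * n + 1) ≤
          HermitianGeometry.scalarCurv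
            (Hirzebruch.hitchinMetric n (1 / (2 * (n : ℝ) ^ 2 + n))) p ∧
        HermitianGeometry.scalarCurv
            (Hirzebruch.hitchinMetric n (1 / (2 * (n : ℝ) ^ 2 + n))) p ≤
          12 * (n : ℝ) ^ 2 + 6 * n) := by
  refine ⟨fun s hs p => Hirzebruch.scalarCurv_bounds hn hs p, fun s hs hsn => ⟨⟨?_, ?_⟩, ?_, ?_⟩,
    fun p => ?_⟩
  · obtain ⟨v, hv, h⟩ := Hirzebruch.exists_holSectCurv_eq_min (n := n) hs
    exact ⟨Hirzebruch.cornerPoint n, v, hv, h⟩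
  · rintro _ ⟨p, ξ, hξ, rfl⟩
    exact (Hirzebruch.holSectCurv_bounds hn hs hsn p hξ).1
  · exact ⟨Hirzebruch.cornerPoint n, (Pi.single 1 1 : Fin 2 → ℂ),
      (by simp : (Pi.single 1 1 : Fin 2 → ℂ) ≠ 0), Hirzebruch.holSectCurv_vertical hs⟩
  · rintro _ ⟨p, ξ, hξ, rfl⟩
    exact (Hirzebruch.holSectCurv_bounds hn hs hsn p hξ).2
  · have hn' : (0 : ℝ) < n := by exact_mod_cast hn
    have h := Hirzebruch.scalarCurv_bounds hn (s := 1 / (2 * (n : ℝ) ^ 2 + n)) (by positivity) p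
    convert h using 2
    · field_simp
      ring
    · field_simp
      ring
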